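/- For each integer $n\ge 1$ let $D$ be a random element (the data, whose distribution may depend on $n$), let $D_1,D_2$ be such that $D,D_1,D_2$ are i.i.d., let $T=T(D)$ be a real-valued statistic and $\mathbf V=\mathbf V(D)=[v_1,\dots,v_n]^\top$ a vector of $n$ real-valued (ancillary) statistics, and write $\mathbf V(D_k)=[v_{k1},\dots,v_{kn}]^\top$, $k\in\{1,2\}$. Assume $\mathrm E\{|T|+(\sum_{j=1}^n v_j^2)^{1/2}\}<\infty$, and define the distance covariance of $T$ and $\mathbf V$ by $$\mathrm{dCov}=\frac{\Gamma(n/2+1/2)}{\pi^{n/2+3/2}}\int_{\mathbb R^{n+1}}\frac{\bigl|\mathrm E e^{\mathrm i tT+\mathrm i\sum_{j}s_jv_j}-\mathrm E e^{\mathrm i tT}\,\mathrm E e^{\mathrm i\sum_{j}s_jv_j}\bigr|^2}{t^2\bigl(\sum_{j=1}^n s_j^2\bigr)^{n/2+1/2}}\,dt\,ds_1\cdots ds_n .$$ Let $b_1=1$, $b_2=-2$, $$R=\sum_{k=1}^2 b_k|T(D)-T(D_k)|+\mathrm E|T(D)-T(D_1)|,$$ $$\varkappa=\frac1n\sum_{i=1}^n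 2\,\mathrm{var}(v_i),\qquad \Delta_n(D,D_1)=\frac1n\sum_{i=1}^n(v_i-v_{1i})^2-\varkappa .$$ (i) For every $n\ge 1$ the integral defining $\mathrm{dCov}$ converges and $\mathrm{dCov}\ge 0$. If moreover $\mathrm E\{|T|(\sum_{j} v_j^2)^{1/2}\}<\infty$, then all expectations below exist and $$\mathrm{dCov}=\mathrm E\Bigl[|T(D)-T(D_1)|\sum_{k=1}^2 b_k\Bigl\{\sum_{j=1}^n(v_j-v_{kj})^2\Bigr\}^{1/2}\Bigr]+\mathrm E|T(D)-T(D_1)|\;\mathrm E\Bigl\{\sum_{j=1}^n(v_j-v_{1j})^2\Bigr\}^{1/2}$$ $$=\mathrm E\Bigl[\Bigl\{\sum_{j=1}^n(v_j-v_{1j})^2\Bigr\}^{1/2}R\Bigr].$$ (ii) If $\mathrm E(T^2)<\infty$ and $\mathrm E|\Delta_n(D,D_1)|^6<\infty$ for every $n\ge1$, and $\varkappa=\varkappa_n$ is bounded away from $0$ for all large $n$, then the expectation of the leading term below exists for every $n\ge1$ with $\varkappa>0$ and, as $n\to\infty$, $$\mathrm{dCov}=n^{1/2}\,\mathrm E\Bigl[\Bigl\{\frac{\Delta_n(D,D_1)}{2\varkappa^{1/2}}-\frac{\Delta_n(D,D_1)^2}{8\varkappa^{3/2}}\Bigr\}R\Bigr]+n^{1/2}\,O\Bigl(\bigl(\mathrm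 E|\Delta_n(D,D_1)|^6\;\mathrm E|T(D)-T(D_1)|^2\bigr)^{1/2}\Bigr).$$ -/

import Mathlib

open MeasureTheory ProbabilityTheory Filter Asymptotics

namespace DistanceCovariance

/-- The weighted squared distance between the joint characteristic function of `(Z, W)` and the
product of the marginal ones, at the point `p = (t, s) ∈ ℝ × ℝⁿ`. -/
noncomputable def dCovIntegrand {Ω : Type*} [MeasurableSpace Ω] (P : Measure Ω) {n : ℕ}
    (Z : Ω → ℝ) (W : Ω → EuclideanSpace ℝ (Fin n)) (p : ℝ × EuclideanSpace ℝ (Fin n)) : ℝ :=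
  ‖(∫ ω, Complex.exp (Complex.I * ((p.1 * Z ω + ∑ j, p.2 j * W ω j : ℝ) : ℂ)) ∂P)
      - (∫ ω, Complex.exp (Complex.I * ((p.1 * Z ω : ℝ) : ℂ)) ∂P)
        * (∫ ω, Complex.exp (Complex.I * ((∑ j, p.2 j * W ω j : ℝ) : ℂ)) ∂P)‖ ^ 2
    / (p.1 ^ 2 * (∑ j, p.2 j ^ 2) ^ ((n : ℝ) / 2 + 1 / 2))

/-- The distance covariance (on the squared scale) of a real random variable `Z` and a random
vector `W` in `ℝⁿ`. The integral is with respect to Lebesgue measure `dt ds₁ ⋯ dsₙ`, and the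
normalization is `1 / (c₁ cₙ)` with `c_d = π ^ ((d + 1) / 2) / Γ((d + 1) / 2)`. -/
noncomputable def dCov {Ω : Type*} [MeasurableSpace Ω] (P : Measure Ω) {n : ℕ}
    (Z : Ω → ℝ) (W : Ω → EuclideanSpace ℝ (Fin n)) : ℝ :=
  Real.Gamma ((n : ℝ) / 2 + 1 / 2) / Real.pi ^ ((n : ℝ) / 2 + 3 / 2)
    * ∫ p : ℝ × EuclideanSpace ℝ (Fin n), dCovIntegrand P Z W p

/-- `ϰ = n⁻¹ ∑ᵢ 2 var(Wᵢ)`. -/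
noncomputable def kap {Ω : Type*} [MeasurableSpace Ω] (P : Measure Ω) {n : ℕ}
    (W : Ω → EuclideanSpace ℝ (Fin n)) : ℝ :=
  1 / (n : ℝ) * ∑ i, 2 * variance (fun ω => W ω i) P

/-- `Δₙ = n⁻¹ ∑ᵢ (Wᵢ - W'ᵢ)² - ϰ`, where `W'` is a copy of `W`. -/
noncomputable def Del {Ω : Type*} [MeasurableSpace Ω] (P : Measure Ω) {n : ℕ}
    (W W' : Ω → EuclideanSpace ℝ (Fin n)) (ω : Ω) : ℝ :=
  1 / (n : ℝ) * ∑ i, (W ω i - W' ω i) ^ 2 - kap P W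

/-- The Euclidean distance `{∑ⱼ (Wⱼ - W'ⱼ)²}^{1/2}`. -/
noncomputable def eDist {Ω : Type*} {n : ℕ}
    (W W' : Ω → EuclideanSpace ℝ (Fin n)) (ω : Ω) : ℝ :=
  √(∑ j, (W ω j - W' ω j) ^ 2)

/-- `R = ∑ₖ bₖ |Z - Zₖ| + E|Z - Z₁|` with `b₁ = 1`, `b₂ = -2`, where `Z₁, Z₂` are copies
of `Z`. -/
noncomputable def Rstat {Ω : Type*} [MeasurableSpace Ω] (P : Measure Ω)
    (Z Z₁ Z₂ : Ω → ℝ) (ω : Ω) : ℝ :=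
  1 * |Z ω - Z₁ ω| + (-2) * |Z ω - Z₂ ω| + ∫ ω', |Z ω' - Z₁ ω'| ∂P

/-- The second-order expression `{Δₙ / (2 ϰ^{1/2}) - Δₙ² / (8 ϰ^{3/2})} R`. -/
noncomputable def mainTerm {Ω : Type*} [MeasurableSpace Ω] (P : Measure Ω) {n : ℕ}
    (Z Z₁ Z₂ : Ω → ℝ) (W W₁ : Ω → EuclideanSpace ℝ (Fin n)) (ω : Ω) : ℝ :=
  (Del P W W₁ ω / (2 * kap P W ^ (1 / 2 : ℝ))
    - Del P W W₁ ω ^ 2 / (8 * kap P W ^ (3 / 2 : ℝ))) * Rstat P Z Z₁ Z₂ ω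

end DistanceCovariance

/-!
The proof rests on the identity `∫ (1 - cos ⟪x, s⟫) / ‖s‖ ^ (d + 1) ds = c_d ‖x‖` in a
`d`-dimensional Euclidean space (`integral_cosKernel`), which follows by writing `‖s‖ ^ -(d + 1)` as
a mixture of Gaussians.

The numerator of the integrand of the distance covariance is the squared covariance of
`exp (i t Z)` and `exp (i ⟪s, W⟫)`. By Cauchy–Schwarz it is at most
`E (1 - cos (t (Z₀ - Z₁))) · E (1 - cos ⟪s, W₀ - W₁⟫)` (`dcovDensity_le`), and the kernel identity
in each variable shows that first moments make the integral converge. Expanded with independent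
copies and symmetrized under `t ↦ -t`, the numerator becomes a combination of three expectations of
products of `1 - cos` (`dcovDensity_add_neg`). Under the mixed moment condition Tonelli's theorem
and the kernel identity evaluate each of them (`integral_dcovDensity`), which gives
`dCov = E |Z₀ - Z₁| ‖W₀ - W₁‖ - 2 E |Z₀ - Z₁| ‖W₀ - W₂‖ + E |Z₀ - Z₁| E ‖W₀ - W₁‖`. Both
representations are regroupings of this, the second one after exchanging the copies `1` and `2`.

For the expansion, `‖W₀ - W₁‖ = √n √(ϰ + Δ)`, and the square root is replaced by its second-order
Taylor polynomial at `ϰ`. Its constant term drops out because `E R = 0` (`memLp_Rstat`), and its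
remainder is at most `|Δ| ^ 3 / ϰ ^ (5/2)` for every `Δ ≥ -ϰ` (`abs_sqrt_sub_taylor_le`), so that
Cauchy–Schwarz gives the error term (`abs_dCov_sub_le`).
-/

namespace DistanceCovariance

/-! ### The kernel integral `∫ (1 - cos ⟪x, s⟫) / ‖s‖ ^ (d + 1) ds = c_d ‖x‖` -/

/-- Tonelli's theorem with the inner integrals `m b` prescribed: integrability of `m` is all that
is needed to integrate `a ↦ ∫ f (a, b) dν` and to exchange the integrals. -/
theorem integrable_integral_of_nonneg {α β : Type*} [MeasurableSpace α] [MeasurableSpace β]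
    {μ : Measure α} {ν : Measure β} [SFinite μ] [SFinite ν] {f : α × β → ℝ} {m : β → ℝ}
    (hf : Measurable f) (hf0 : ∀ᵐ b ∂ν, ∀ᵐ a ∂μ, 0 ≤ f (a, b))
    (hint : ∀ᵐ b ∂ν, Integrable (fun a => f (a, b)) μ)
    (hval : ∀ᵐ b ∂ν, ∫ a, f (a, b) ∂μ = m b) (hm : Integrable m ν) :
    Integrable (fun a => ∫ b, f (a, b) ∂ν) μ ∧ ∫ a, ∫ b, f (a, b) ∂ν ∂μ = ∫ b, m b ∂ν := by
  have hi : Integrable f (μ.prod ν) := by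
    rw [integrable_prod_iff' hf.aestronglyMeasurable]
    refine ⟨hint, hm.congr ?_⟩
    filter_upwards [hval, hf0] with b hb hb0
    rw [← hb]
    refine integral_congr_ae ?_
    filter_upwards [hb0] with a ha
    exact (Real.norm_of_nonneg ha).symm
  refine ⟨hi.integral_prod_left, ?_⟩
  rw [integral_integral_swap (f := fun a b => f (a, b)) hi]
  exact integral_congr_ae hval

/-- Write `v ^ (-3/2) (1 - e ^ (-a v))` as `∫ v ^ (-1/2) e ^ (-b v) db` over `0 < b ≤ a`; the integral
in `v` is then a Gamma integral, `Γ(1/2) b ^ (-1/2)`. -/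
theorem integral_rpow_mul_one_sub_exp_neg {a : ℝ} (ha : 0 ≤ a) :
    IntegrableOn (fun v : ℝ => v ^ (-(3 / 2) : ℝ) * (1 - Real.exp (-(a * v)))) (Set.Ioi 0) ∧
      ∫ v in Set.Ioi (0 : ℝ), v ^ (-(3 / 2) : ℝ) * (1 - Real.exp (-(a * v)))
        = 2 * √Real.pi * √a := by
  have hm : IntegrableOn (fun b : ℝ => b ^ (-(1 / 2) : ℝ) * √Real.pi) (Set.Ioc 0 a) := by
    have := (intervalIntegral.intervalIntegrable_rpow' (a := 0) (b := a)
      (r := -(1 / 2)) (by norm_num)).mul_const √Real.pi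
    exact (intervalIntegrable_iff_integrableOn_Ioc_of_le ha).1 this
  have key := integrable_integral_of_nonneg (μ := volume.restrict (Set.Ioi (0 : ℝ)))
    (ν := volume.restrict (Set.Ioc (0 : ℝ) a))
    (f := fun p => p.1 ^ ((1 / 2 : ℝ) - 1) * Real.exp (-(p.2 * p.1)))
    (m := fun b => b ^ (-(1 / 2) : ℝ) * √Real.pi)
    (by fun_prop) ?_ ?_ ?_ hm
  rotate_left
  · refine ae_of_all _ fun b => (ae_restrict_iff' measurableSet_Ioi).2 (ae_of_all _ fun v hv => ?_)
    exact mul_nonneg (Real.rpow_nonneg (le_of_lt hv) _) (Real.exp_nonneg _)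
  · refine (ae_restrict_iff' measurableSet_Ioc).2 (ae_of_all _ fun b hb => ?_)
    have := integrableOn_rpow_mul_exp_neg_mul_rpow (s := (1 / 2 : ℝ) - 1) (p := 1) (b := b)
      (by norm_num) one_pos hb.1
    simpa [IntegrableOn] using this
  · refine (ae_restrict_iff' measurableSet_Ioc).2 (ae_of_all _ fun b hb => ?_)
    dsimp only
    rw [Real.integral_rpow_mul_exp_neg_mul_Ioi (by norm_num) hb.1, Real.Gamma_one_half_eq,
      one_div, Real.inv_rpow hb.1.le, Real.rpow_neg hb.1.le]
  have hinner : ∀ v ∈ Set.Ioi (0 : ℝ),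
      ∫ b in Set.Ioc 0 a, v ^ ((1 / 2 : ℝ) - 1) * Real.exp (-(b * v))
        = v ^ (-(3 / 2) : ℝ) * (1 - Real.exp (-(a * v))) := by
    intro v hv
    have hv' : (0 : ℝ) < v := hv
    rw [integral_const_mul, ← intervalIntegral.integral_of_le ha]
    have hder : ∀ b ∈ Set.uIcc 0 a,
        HasDerivAt (fun b => -(Real.exp (-(b * v)) / v)) (Real.exp (-(b * v))) b := by
      intro b _
      have h1 : HasDerivAt (fun b : ℝ => -(b * v)) (-(1 * v)) b :=
        ((hasDerivAt_id b).mul_const v).neg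
      convert! (h1.exp.div_const v).neg using 1
      field_simp
    rw [intervalIntegral.integral_eq_sub_of_hasDerivAt hder
      (by apply Continuous.intervalIntegrable; fun_prop)]
    have h2 : v ^ ((1 / 2 : ℝ) - 1) = v ^ (-(3 / 2) : ℝ) * v := by
      rw [← Real.rpow_add_one hv'.ne']; norm_num
    rw [h2]
    simp
    field_simp
    ring
  refine ⟨(integrableOn_congr_fun hinner measurableSet_Ioi).1 key.1, ?_⟩
  rw [← setIntegral_congr_fun measurableSet_Ioi hinner, key.2, integral_mul_const,
    ← intervalIntegral.integral_of_le ha, integral_rpow (Or.inl (by norm_num)), Real.sqrt_eq_rpow a]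
  norm_num
  ring

/-- The previous integral after the substitution `v = 1 / u`. -/
theorem integral_rpow_mul_one_sub_exp_neg_div {a : ℝ} (ha : 0 ≤ a) :
    IntegrableOn (fun u : ℝ => u ^ (-(1 / 2) : ℝ) * (1 - Real.exp (-(a / u)))) (Set.Ioi 0) ∧
      ∫ u in Set.Ioi (0 : ℝ), u ^ (-(1 / 2) : ℝ) * (1 - Real.exp (-(a / u)))
        = 2 * √Real.pi * √a := by
  obtain ⟨h1, h2⟩ := integral_rpow_mul_one_sub_exp_neg ha
  have heq : ∀ u ∈ Set.Ioi (0 : ℝ), (|(-1 : ℝ)| * u ^ ((-1 : ℝ) - 1)) •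
      ((u ^ (-1 : ℝ)) ^ (-(3 / 2) : ℝ) * (1 - Real.exp (-(a * u ^ (-1 : ℝ)))))
        = u ^ (-(1 / 2) : ℝ) * (1 - Real.exp (-(a / u))) := by
    intro u hu
    have hu' : (0 : ℝ) < u := hu
    rw [← Real.rpow_mul hu'.le, smul_eq_mul, ← mul_assoc, mul_assoc |(-1 : ℝ)|,
      ← Real.rpow_add hu', Real.rpow_neg_one, ← div_eq_mul_inv]
    norm_num
  refine ⟨(integrableOn_congr_fun heq measurableSet_Ioi).1
    ((integrableOn_Ioi_comp_rpow_iff _ (by norm_num : (-1 : ℝ) ≠ 0)).2 h1), ?_⟩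
  rw [← h2, ← setIntegral_congr_fun measurableSet_Ioi heq]
  exact integral_comp_rpow_Ioi (fun v : ℝ => v ^ (-(3 / 2) : ℝ) * (1 - Real.exp (-(a * v))))
    (by norm_num)

section Kernel

variable {E : Type*} [NormedAddCommGroup E] [InnerProductSpace ℝ E]

/-- The constant `c_d = π ^ ((d + 1) / 2) / Γ((d + 1) / 2)` of the kernel integral in dimension
`d`. -/
noncomputable def kernelConst (d : ℕ) : ℝ :=
  Real.pi ^ ((d : ℝ) / 2 + 1 / 2) / Real.Gamma ((d : ℝ) / 2 + 1 / 2)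

/-- The kernel `(1 - cos ⟪x, s⟫) / ‖s‖ ^ (d + 1)`, with `d` the dimension of the space. The power is
written `(‖s‖ ^ 2) ^ (d / 2 + 1 / 2)`, so that in dimension one it is literally `s ^ 2`. At `s = 0`
the numerator vanishes, so the kernel is `0` there. -/
noncomputable def cosKernel (s x : E) : ℝ :=
  (1 - Real.cos (inner ℝ x s)) / (‖s‖ ^ 2) ^ ((Module.finrank ℝ E : ℝ) / 2 + 1 / 2)

theorem cosKernel_nonneg (s x : E) : 0 ≤ cosKernel s x :=
  div_nonneg (sub_nonneg.2 (Real.cos_le_one _)) (by positivity)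

variable [FiniteDimensional ℝ E] [MeasurableSpace E] [BorelSpace E]

/-- The difference of the Fourier transform of a Gaussian at `0` and at `x`. -/
theorem integral_one_sub_cos_mul_exp_neg_mul_sq_norm {b : ℝ} (hb : 0 < b) (x : E) :
    Integrable (fun s : E => (1 - Real.cos (inner ℝ x s)) * Real.exp (-b * ‖s‖ ^ 2)) ∧
      ∫ s : E, (1 - Real.cos (inner ℝ x s)) * Real.exp (-b * ‖s‖ ^ 2)
        = (Real.pi / b) ^ ((Module.finrank ℝ E : ℝ) / 2)
          * (1 - Real.exp (-(‖x‖ ^ 2 / 4 / b))) := by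
  have hb' : 0 < (b : ℂ).re := hb
  have hi := GaussianFourier.integrable_cexp_neg_mul_sq_norm_add (V := E) hb' Complex.I x
  have hv := GaussianFourier.integral_cexp_neg_mul_sq_norm_add (V := E) hb' Complex.I x
  have hi0 := GaussianFourier.integrable_cexp_neg_mul_sq_norm_add (V := E) hb' 0 0
  have hre : ∀ s : E, (Complex.exp (-b * ‖s‖ ^ 2 + Complex.I * (inner ℝ x s : ℝ))).re
      = Real.cos (inner ℝ x s) * Real.exp (-b * ‖s‖ ^ 2) := by
    intro s
    rw [Complex.exp_re]
    simp [← Complex.ofReal_pow]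
    ring
  have hre0 : ∀ s : E, (Complex.exp (-b * ‖s‖ ^ 2 + 0 * (inner ℝ (0 : E) s : ℝ))).re
      = Real.exp (-b * ‖s‖ ^ 2) := by
    intro s
    rw [Complex.exp_re]
    simp [← Complex.ofReal_pow]
  have i1 : Integrable (fun s : E => Real.cos (inner ℝ x s) * Real.exp (-b * ‖s‖ ^ 2)) :=
    hi.re.congr (ae_of_all _ hre)
  have i0 : Integrable (fun s : E => Real.exp (-b * ‖s‖ ^ 2)) :=
    hi0.re.congr (ae_of_all _ hre0)
  have v1 : ∫ s : E, Real.cos (inner ℝ x s) * Real.exp (-b * ‖s‖ ^ 2)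
      = (Real.pi / b) ^ ((Module.finrank ℝ E : ℝ) / 2) * Real.exp (-(‖x‖ ^ 2 / 4 / b)) := by
    have h1 : ∫ s : E, Real.cos (inner ℝ x s) * Real.exp (-b * ‖s‖ ^ 2)
        = (∫ s : E, Complex.exp (-b * ‖s‖ ^ 2 + Complex.I * (inner ℝ x s : ℝ))).re := by
      rw [← RCLike.re_eq_complex_re, ← integral_re hi]
      exact integral_congr_ae (ae_of_all _ fun s => (hre s).symm)
    rw [h1, hv]
    have h2 : ((Real.pi / b : ℂ)) ^ ((Module.finrank ℝ E : ℂ) / 2)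
        * Complex.exp (Complex.I ^ 2 * ‖x‖ ^ 2 / (4 * b))
        = (((Real.pi / b) ^ ((Module.finrank ℝ E : ℝ) / 2)
          * Real.exp (-(‖x‖ ^ 2 / 4 / b)) : ℝ) : ℂ) := by
      push_cast
      rw [Complex.ofReal_cpow (by positivity)]
      push_cast
      congr 2
      rw [Complex.I_sq]
      field_simp
    rw [h2, Complex.ofReal_re]
  have hsplit : (fun s : E => (1 - Real.cos (inner ℝ x s)) * Real.exp (-b * ‖s‖ ^ 2))
      = fun s => Real.exp (-b * ‖s‖ ^ 2) - Real.cos (inner ℝ x s) * Real.exp (-b * ‖s‖ ^ 2) := by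
    ext s; ring
  rw [hsplit]
  refine ⟨i0.sub i1, ?_⟩
  rw [integral_sub i0 i1, v1, GaussianFourier.integral_rexp_neg_mul_sq_norm hb]
  ring

theorem measurable_cosKernel {α : Type*} [MeasurableSpace α] {f g : α → E}
    (hf : Measurable f) (hg : Measurable g) : Measurable fun a => cosKernel (f a) (g a) := by
  unfold cosKernel
  fun_prop

/-- Gaussian subordination: `Γ(q) / ‖s‖ ^ (2 q) = ∫ u ^ (q - 1) e ^ (-u ‖s‖ ^ 2) du` over `u > 0`, with
`q = (d + 1) / 2`, turns the kernel into a mixture of Gaussians, whose Fourier transforms are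
known. -/
theorem integral_cosKernel (x : E) :
    Integrable (fun s : E => cosKernel s x) ∧
      ∫ s : E, cosKernel s x = kernelConst (Module.finrank ℝ E) * ‖x‖ := by
  set d : ℝ := ((Module.finrank ℝ E : ℕ) : ℝ) with hd
  have hd0 : 0 ≤ d := by positivity
  set q : ℝ := d / 2 + 1 / 2 with hq
  have hq0 : 0 < q := by positivity
  have hΓ : 0 < Real.Gamma q := Real.Gamma_pos_of_pos hq0
  obtain ⟨m1, m2⟩ := integral_rpow_mul_one_sub_exp_neg_div (a := ‖x‖ ^ 2 / 4) (by positivity)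
  have key := integrable_integral_of_nonneg (μ := (volume : Measure E))
    (ν := volume.restrict (Set.Ioi (0 : ℝ)))
    (f := fun p => p.2 ^ (q - 1) * ((1 - Real.cos (inner ℝ x p.1)) * Real.exp (-p.2 * ‖p.1‖ ^ 2)))
    (m := fun u => Real.pi ^ (d / 2) * (u ^ (-(1 / 2) : ℝ)
      * (1 - Real.exp (-(‖x‖ ^ 2 / 4 / u)))))
    (by fun_prop) ?_ ?_ ?_ (m1.const_mul _)
  rotate_left
  · refine (ae_restrict_iff' measurableSet_Ioi).2 (ae_of_all _ fun u hu => ae_of_all _ fun s => ?_)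
    exact mul_nonneg (Real.rpow_nonneg (le_of_lt hu) _)
      (mul_nonneg (sub_nonneg.2 (Real.cos_le_one _)) (Real.exp_nonneg _))
  · refine (ae_restrict_iff' measurableSet_Ioi).2 (ae_of_all _ fun u hu => ?_)
    exact (integral_one_sub_cos_mul_exp_neg_mul_sq_norm hu x).1.const_mul (u ^ (q - 1))
  · refine (ae_restrict_iff' measurableSet_Ioi).2 (ae_of_all _ fun u hu => ?_)
    have hu' : (0 : ℝ) < u := hu
    dsimp only
    rw [integral_const_mul, (integral_one_sub_cos_mul_exp_neg_mul_sq_norm hu x).2, ← mul_assoc,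
      ← mul_assoc, Real.div_rpow Real.pi_pos.le hu'.le]
    congr 1
    have : u ^ (q - 1) = u ^ (-(1 / 2) : ℝ) * u ^ (d / 2) := by
      rw [← Real.rpow_add hu']; congr 1; rw [hq]; ring
    rw [this, ← hd]
    field_simp
  have hinner : ∀ s : E, ∫ u in Set.Ioi (0 : ℝ),
      u ^ (q - 1) * ((1 - Real.cos (inner ℝ x s)) * Real.exp (-u * ‖s‖ ^ 2))
        = Real.Gamma q * cosKernel s x := by
    intro s
    -- At `s = 0` the Gamma integral diverges, but both sides carry the factor `1 - cos 0 = 0`.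
    rcases eq_or_ne s 0 with rfl | hs
    · simp [cosKernel]
    have hs' : 0 < ‖s‖ ^ 2 := by positivity
    have : ∀ u : ℝ, u ^ (q - 1) * ((1 - Real.cos (inner ℝ x s)) * Real.exp (-u * ‖s‖ ^ 2))
        = (1 - Real.cos (inner ℝ x s)) * (u ^ (q - 1) * Real.exp (-(‖s‖ ^ 2 * u))) := by
      intro u
      rw [show -u * ‖s‖ ^ 2 = -(‖s‖ ^ 2 * u) by ring]
      ring
    simp_rw [this]
    rw [integral_const_mul, Real.integral_rpow_mul_exp_neg_mul_Ioi hq0 hs', cosKernel, ← hd, ← hq,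
      one_div, Real.inv_rpow hs'.le]
    ring
  simp_rw [hinner] at key
  obtain ⟨k1, k2⟩ := key
  refine ⟨(integrable_const_mul_iff (isUnit_iff_ne_zero.2 hΓ.ne') _).1 k1, ?_⟩
  rw [integral_const_mul, integral_const_mul, m2] at k2
  have hx : √(‖x‖ ^ 2 / 4) = ‖x‖ / 2 := by
    rw [show ‖x‖ ^ 2 / 4 = (‖x‖ / 2) ^ 2 by ring, Real.sqrt_sq (by positivity)]
  rw [kernelConst, ← hd, ← hq, div_mul_eq_mul_div, eq_div_iff hΓ.ne', mul_comm, k2, hx, hq,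
    Real.rpow_add Real.pi_pos, ← Real.sqrt_eq_rpow]
  ring

end Kernel

/-! ### Characteristic functions and covariances of complex exponentials -/

section

variable {Ω : Type*} [MeasurableSpace Ω] {P : Measure Ω}

/-- The characteristic function of the real random variable `U` at `1`, that is `E exp (i U)`.
Taking `U = ⟪X, t⟫` gives the characteristic function of a random vector `X` at `t`. -/
noncomputable def chr (P : Measure Ω) (U : Ω → ℝ) : ℂ := ∫ ω, Complex.exp (Complex.I * (U ω : ℂ)) ∂P

theorem norm_cexp_I_mul (x : ℝ) : ‖Complex.exp (Complex.I * (x : ℂ))‖ = 1 := by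
  rw [mul_comm]; exact Complex.norm_exp_ofReal_mul_I x

theorem integrable_cexp_I_mul [IsFiniteMeasure P] {U : Ω → ℝ} (hU : Measurable U) :
    Integrable (fun ω => Complex.exp (Complex.I * (U ω : ℂ))) P :=
  Integrable.of_bound (by fun_prop) 1 (ae_of_all _ fun ω => (norm_cexp_I_mul _).le)

theorem re_chr [IsFiniteMeasure P] {U : Ω → ℝ} (hU : Measurable U) :
    (chr P U).re = ∫ ω, Real.cos (U ω) ∂P := by
  rw [chr, ← RCLike.re_eq_complex_re, ← integral_re (integrable_cexp_I_mul hU)]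
  refine integral_congr_ae (ae_of_all _ fun ω => ?_)
  simp [mul_comm Complex.I, Complex.exp_ofReal_mul_I_re]

theorem conj_chr (U : Ω → ℝ) : (starRingEnd ℂ) (chr P U) = chr P (fun ω => -U ω) := by
  rw [chr, ← integral_conj, chr]
  refine integral_congr_ae (ae_of_all _ fun ω => ?_)
  simp [← Complex.exp_conj]

theorem chr_mul_chr {U V : Ω → ℝ} (hU : Measurable U) (hV : Measurable V) (h : IndepFun U V P) :
    chr P U * chr P V = chr P (fun ω => U ω + V ω) := by
  have hm : Measurable fun x : ℝ => Complex.exp (Complex.I * (x : ℂ)) := by fun_prop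
  have := (h.comp hm hm).integral_fun_mul_eq_mul_integral
    (hm.comp hU).aestronglyMeasurable (hm.comp hV).aestronglyMeasurable
  simp only [Function.comp_apply] at this
  rw [chr, chr, ← this, chr]
  refine integral_congr_ae (ae_of_all _ fun ω => ?_)
  simp [mul_add, Complex.exp_add]

theorem chr_mul_conj_chr {U V : Ω → ℝ} (hU : Measurable U) (hV : Measurable V)
    (h : IndepFun U V P) :
    chr P U * (starRingEnd ℂ) (chr P V) = chr P (fun ω => U ω - V ω) := by
  have hneg : Measurable fun ω => -V ω := hV.neg
  rw [conj_chr, chr_mul_chr hU hneg (h.comp measurable_id measurable_neg)]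
  simp_rw [sub_eq_add_neg]

theorem chr_congr {U V : Ω → ℝ} (h : IdentDistrib U V P P) : chr P U = chr P V :=
  (h.comp (u := fun x : ℝ => Complex.exp (Complex.I * (x : ℂ))) (by fun_prop)).integral_eq

/-- With an independent copy `V` of `U`, `|E exp (i U)| ^ 2 = E cos (U - V)`. -/
theorem sq_norm_chr {U V : Ω → ℝ} [IsFiniteMeasure P] (hU : Measurable U) (hV : Measurable V)
    (h : IndepFun U V P) (hid : IdentDistrib V U P P) :
    ‖chr P U‖ ^ 2 = ∫ ω, Real.cos (U ω - V ω) ∂P := by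
  have h1 := chr_mul_conj_chr hU hV h
  rw [chr_congr hid, Complex.mul_conj'] at h1
  have hsub : Measurable fun ω => U ω - V ω := hU.sub hV
  rw [← re_chr hsub, ← h1, ← Complex.ofReal_pow, Complex.ofReal_re]

/-- The Cauchy–Schwarz inequality for real square-integrable functions. -/
theorem sq_integral_mul_le {f g : Ω → ℝ} (hf : MemLp f 2 P) (hg : MemLp g 2 P) :
    (∫ ω, f ω * g ω ∂P) ^ 2 ≤ (∫ ω, f ω ^ 2 ∂P) * ∫ ω, g ω ^ 2 ∂P := by
  have h := integral_mul_norm_le_Lp_mul_Lq (μ := P) (f := f) (g := g)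
    Real.HolderConjugate.two_two (by simpa using hf) (by simpa using hg)
  have h1 : |∫ ω, f ω * g ω ∂P| ≤ ∫ ω, ‖f ω‖ * ‖g ω‖ ∂P := by
    refine (abs_integral_le_integral_abs).trans_eq ?_
    simp [abs_mul]
  have hf0 : 0 ≤ ∫ ω, f ω ^ 2 ∂P := integral_nonneg fun _ => sq_nonneg _
  have hg0 : 0 ≤ ∫ ω, g ω ^ 2 ∂P := integral_nonneg fun _ => sq_nonneg _
  simp only [Real.norm_eq_abs, Real.rpow_two, sq_abs, ← Real.sqrt_eq_rpow] at h h1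
  rw [← Real.sqrt_mul hf0] at h
  rw [← sq_abs, ← Real.sq_sqrt (mul_nonneg hf0 hg0)]
  exact pow_le_pow_left₀ (abs_nonneg _) (h1.trans h) 2

/-- The variance of `exp (i U)`. -/
theorem integral_sq_norm_sub_chr [IsProbabilityMeasure P] {U : Ω → ℝ} (hU : Measurable U) :
    ∫ ω, ‖Complex.exp (Complex.I * (U ω : ℂ)) - chr P U‖ ^ 2 ∂P = 1 - ‖chr P U‖ ^ 2 := by
  have h : ∀ ω, ‖Complex.exp (Complex.I * (U ω : ℂ)) - chr P U‖ ^ 2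
      = 1 + ‖chr P U‖ ^ 2
        - 2 * (Complex.exp (Complex.I * (U ω : ℂ)) * (starRingEnd ℂ) (chr P U)).re := by
    intro ω
    rw [← Complex.normSq_eq_norm_sq, Complex.normSq_sub, Complex.normSq_eq_norm_sq,
      Complex.normSq_eq_norm_sq, norm_cexp_I_mul]
    ring
  have hi := (integrable_cexp_I_mul (P := P) hU).mul_const ((starRingEnd ℂ) (chr P U))
  have hre : ∫ ω, (Complex.exp (Complex.I * (U ω : ℂ)) * (starRingEnd ℂ) (chr P U)).re ∂P
      = ‖chr P U‖ ^ 2 := by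
    have := integral_re hi
    simp only [RCLike.re_eq_complex_re] at this
    rw [this, integral_mul_const, ← chr, Complex.mul_conj', ← Complex.ofReal_pow,
      Complex.ofReal_re]
  have hi' : Integrable (fun ω =>
      2 * (Complex.exp (Complex.I * (U ω : ℂ)) * (starRingEnd ℂ) (chr P U)).re) P :=
    hi.re.const_mul 2
  simp_rw [h]
  rw [integral_sub (integrable_const _) hi', integral_const_mul, hre]
  simp
  ring

/-- Cauchy–Schwarz for the covariance of `exp (i U)` and `exp (i V)`. -/
theorem sq_norm_chr_add_sub_le [IsProbabilityMeasure P] {U V : Ω → ℝ} (hU : Measurable U)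
    (hV : Measurable V) :
    ‖chr P (fun ω => U ω + V ω) - chr P U * chr P V‖ ^ 2
      ≤ (1 - ‖chr P U‖ ^ 2) * (1 - ‖chr P V‖ ^ 2) := by
  set eU : Ω → ℂ := fun ω => Complex.exp (Complex.I * (U ω : ℂ)) with heU
  set eV : Ω → ℂ := fun ω => Complex.exp (Complex.I * (V ω : ℂ)) with heV
  have iU : Integrable eU P := integrable_cexp_I_mul hU
  have iV : Integrable eV P := integrable_cexp_I_mul hV
  have iUV : Integrable (fun ω => eU ω * eV ω) P := by
    refine (integrable_cexp_I_mul (P := P) (hU.add hV)).congr (ae_of_all _ fun ω => ?_)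
    simp [heU, heV, mul_add, Complex.exp_add]
  have hcov : chr P (fun ω => U ω + V ω) - chr P U * chr P V
      = ∫ ω, (eU ω - chr P U) * (eV ω - chr P V) ∂P := by
    have h1 : ∀ ω, (eU ω - chr P U) * (eV ω - chr P V)
        = eU ω * eV ω - eU ω * chr P V - chr P U * eV ω + chr P U * chr P V := fun ω => by ring
    have h2 : chr P (fun ω => U ω + V ω) = ∫ ω, eU ω * eV ω ∂P :=
      integral_congr_ae (ae_of_all _ fun ω => by simp [heU, heV, mul_add, Complex.exp_add])
    have i1 : Integrable (fun ω => eU ω * eV ω - eU ω * chr P V) P := iUV.sub (iU.mul_const _)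
    have i2 : Integrable (fun ω => eU ω * eV ω - eU ω * chr P V - chr P U * eV ω) P :=
      i1.sub (iV.const_mul _)
    simp_rw [h1]
    rw [integral_add i2 (integrable_const _), integral_sub i1 (iV.const_mul _),
      integral_sub iUV (iU.mul_const _), integral_mul_const, integral_const_mul, ← h2]
    change _ = _ - chr P U * chr P V - chr P U * chr P V + _
    simp
  have hL : ∀ {T : Ω → ℝ}, Measurable T →
      MemLp (fun ω => ‖Complex.exp (Complex.I * (T ω : ℂ)) - chr P T‖) 2 P := by
    intro T hT
    refine MemLp.of_bound (by fun_prop) (1 + ‖chr P T‖) (ae_of_all _ fun ω => ?_)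
    rw [norm_norm]
    exact (norm_sub_le _ _).trans_eq (by rw [norm_cexp_I_mul])
  have hcs := sq_integral_mul_le (hL hU) (hL hV)
  rw [integral_sq_norm_sub_chr hU, integral_sq_norm_sub_chr hV] at hcs
  refine le_trans ?_ hcs
  rw [hcov]
  refine pow_le_pow_left₀ (norm_nonneg _) ?_ 2
  refine (norm_integral_le_integral_norm _).trans_eq ?_
  simp [heU, heV]

end

/-! ### The density of the distance covariance in terms of independent copies -/

section

variable {Ω : Type*} [MeasurableSpace Ω] {P : Measure Ω}
  {E : Type*} [MeasurableSpace E] {F : Type*} [MeasurableSpace F]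

/-- The pairs `(X k, Y k)`, `k = 0, 1, 2`, are independent and identically distributed (each `X k`
may depend on `Y k`). -/
structure IIDPairs (P : Measure Ω) (X : Fin 3 → Ω → E) (Y : Fin 3 → Ω → F) : Prop where
  measurable_fst : ∀ k, Measurable (X k)
  measurable_snd : ∀ k, Measurable (Y k)
  indep : iIndepFun (fun k ω => (X k ω, Y k ω)) P
  ident : ∀ k, IdentDistrib (fun ω => (X k ω, Y k ω)) (fun ω => (X 0 ω, Y 0 ω)) P P

variable {X : Fin 3 → Ω → E} {Y : Fin 3 → Ω → F}

/-- Three i.i.d. pairs are exchangeable. -/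
theorem IIDPairs.integral_perm (h : IIDPairs P X Y) (σ : Equiv.Perm (Fin 3))
    {g : (Fin 3 → E × F) → ℝ} (hg : Measurable g) :
    ∫ ω, g (fun k => (X (σ k) ω, Y (σ k) ω)) ∂P = ∫ ω, g (fun k => (X k ω, Y k ω)) ∂P := by
  have := IdentDistrib.pi (X := fun k ω => (X (σ k) ω, Y (σ k) ω))
    (Y := fun k ω => (X k ω, Y k ω)) (fun k => (h.ident (σ k)).trans (h.ident k).symm)
    (h.indep.precomp σ.injective) h.indep
  exact (this.comp hg).integral_eq

theorem IIDPairs.swap (h : IIDPairs P X Y) : IIDPairs P Y X where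
  measurable_fst := h.measurable_snd
  measurable_snd := h.measurable_fst
  indep := h.indep.comp (fun _ => Prod.swap) fun _ => measurable_swap
  ident k := (h.ident k).comp measurable_swap

theorem IIDPairs.integrable_norm_sub_fst [NormedAddCommGroup E] [OpensMeasurableSpace E]
    [SecondCountableTopology E] (h : IIDPairs P X Y)
    (hi : Integrable (fun ω => ‖X 0 ω‖) P) (j k : Fin 3) :
    Integrable (fun ω => ‖X j ω - X k ω‖) P := by
  have hk : ∀ k, Integrable (X k) P := fun k => by
    rw [← integrable_norm_iff (h.measurable_fst k).aestronglyMeasurable]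
    exact ((h.ident k).comp (u := fun q : E × F => ‖q.1‖) (by fun_prop)).integrable_iff.2 hi
  exact ((hk j).sub (hk k)).norm

end

section

variable {Ω : Type*} [MeasurableSpace Ω] {P : Measure Ω}
  {E : Type*} [NormedAddCommGroup E] [InnerProductSpace ℝ E]
  {F : Type*} [NormedAddCommGroup F] [InnerProductSpace ℝ F]

/-- The density whose integral is the distance covariance of `U` and `V`, up to normalization, for
random vectors in two Euclidean spaces; the weights are those of `cosKernel`. -/
noncomputable def dcovDensity (P : Measure Ω) (U : Ω → E) (V : Ω → F) (p : E × F) : ℝ :=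
  ‖chr P (fun ω => inner ℝ (U ω) p.1 + inner ℝ (V ω) p.2)
      - chr P (fun ω => inner ℝ (U ω) p.1) * chr P (fun ω => inner ℝ (V ω) p.2)‖ ^ 2
    / ((‖p.1‖ ^ 2) ^ ((Module.finrank ℝ E : ℝ) / 2 + 1 / 2)
      * (‖p.2‖ ^ 2) ^ ((Module.finrank ℝ F : ℝ) / 2 + 1 / 2))

theorem dcovDensity_nonneg (U : Ω → E) (V : Ω → F) (p : E × F) : 0 ≤ dcovDensity P U V p := by
  unfold dcovDensity; positivity

variable [FiniteDimensional ℝ E] [MeasurableSpace E] [BorelSpace E]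
  [FiniteDimensional ℝ F] [MeasurableSpace F] [BorelSpace F]
  {X : Fin 3 → Ω → E} {Y : Fin 3 → Ω → F}

/-- Expanding the square: each of the three terms is the expectation of a cosine, once the
product of the marginal characteristic functions is computed from the copies `1` and `2`. -/
theorem sq_norm_chr_sub [IsProbabilityMeasure P] (h : IIDPairs P X Y) (t : E) (s : F) :
    ‖chr P (fun ω => inner ℝ (X 0 ω) t + inner ℝ (Y 0 ω) s)
        - chr P (fun ω => inner ℝ (X 0 ω) t) * chr P (fun ω => inner ℝ (Y 0 ω) s)‖ ^ 2
      = ∫ ω, Real.cos (inner ℝ (X 0 ω - X 1 ω) t + inner ℝ (Y 0 ω - Y 1 ω) s) ∂P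
        - 2 * ∫ ω, Real.cos (inner ℝ (X 0 ω - X 1 ω) t + inner ℝ (Y 0 ω - Y 2 ω) s) ∂P
        + (∫ ω, Real.cos (inner ℝ (X 0 ω - X 1 ω) t) ∂P)
          * ∫ ω, Real.cos (inner ℝ (Y 0 ω - Y 1 ω) s) ∂P := by
  have hX := h.measurable_fst
  have hY := h.measurable_snd
  have hXY : ∀ k, Measurable fun ω => (X k ω, Y k ω) := fun k => (hX k).prodMk (hY k)
  have hf : Measurable fun q : E × F => inner ℝ q.1 t := by fun_prop
  have hg : Measurable fun q : E × F => inner ℝ q.2 s := by fun_prop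
  have hfg : Measurable fun q : E × F => inner ℝ q.1 t + inner ℝ q.2 s := by fun_prop
  have h01 : IndepFun (fun ω => (X 0 ω, Y 0 ω)) (fun ω => (X 1 ω, Y 1 ω)) P :=
    h.indep.indepFun (by decide)
  have h12 : IndepFun (fun ω => (X 1 ω, Y 1 ω)) (fun ω => (X 2 ω, Y 2 ω)) P :=
    h.indep.indepFun (by decide)
  have h012 : IndepFun (fun ω => (X 0 ω, Y 0 ω))
      (fun ω => ((X 1 ω, Y 1 ω), (X 2 ω, Y 2 ω))) P :=
    (h.indep.indepFun_prodMk hXY 1 2 0 (by decide) (by decide)).symm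
  have mf : ∀ k, Measurable fun ω => inner ℝ (X k ω) t := fun k => hf.comp (hXY k)
  have mg : ∀ k, Measurable fun ω => inner ℝ (Y k ω) s := fun k => hg.comp (hXY k)
  have mfg : ∀ j k, Measurable fun ω => inner ℝ (X j ω) t + inner ℝ (Y k ω) s := fun j k =>
    (mf j).add (mg k)
  have eA := sq_norm_chr (mfg 0 0) (mfg 1 1) (h01.comp hfg hfg) ((h.ident 1).comp hfg)
  have eB := sq_norm_chr (mf 0) (mf 1) (h01.comp hf hf) ((h.ident 1).comp hf)
  have eC := sq_norm_chr (mg 0) (mg 1) (h01.comp hg hg) ((h.ident 1).comp hg)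
  have eM : chr P (fun ω => inner ℝ (X 0 ω) t) * chr P (fun ω => inner ℝ (Y 0 ω) s)
      = chr P (fun ω => inner ℝ (X 1 ω) t + inner ℝ (Y 2 ω) s) := by
    have b1 : chr P (fun ω => inner ℝ (X 1 ω) t) = chr P (fun ω => inner ℝ (X 0 ω) t) :=
      chr_congr ((h.ident 1).comp hf)
    have b2 : chr P (fun ω => inner ℝ (Y 2 ω) s) = chr P (fun ω => inner ℝ (Y 0 ω) s) :=
      chr_congr ((h.ident 2).comp hg)
    rw [← b1, ← b2, chr_mul_chr (mf 1) (mg 2) (h12.comp hf hg)]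
  have eAM := congrArg Complex.re (chr_mul_conj_chr (mfg 0 0) (mfg 1 2)
    (h012.comp (φ := fun q : E × F => inner ℝ q.1 t + inner ℝ q.2 s)
      (ψ := fun q : (E × F) × (E × F) => inner ℝ q.1.1 t + inner ℝ q.2.2 s) hfg (by fun_prop)))
  have mdiff : Measurable fun ω => inner ℝ (X 0 ω) t + inner ℝ (Y 0 ω) s
      - (inner ℝ (X 1 ω) t + inner ℝ (Y 2 ω) s) := (mfg 0 0).sub (mfg 1 2)
  rw [re_chr mdiff] at eAM
  rw [← Complex.normSq_eq_norm_sq, Complex.normSq_sub, Complex.normSq_eq_norm_sq,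
    Complex.normSq_eq_norm_sq]
  nth_rewrite 2 [eM]
  rw [norm_mul, mul_pow, eB, eC]
  have c1 : ∀ ω, inner ℝ (X 0 ω) t + inner ℝ (Y 0 ω) s - (inner ℝ (X 1 ω) t + inner ℝ (Y 1 ω) s)
      = inner ℝ (X 0 ω - X 1 ω) t + inner ℝ (Y 0 ω - Y 1 ω) s := fun ω => by
    simp only [inner_sub_left]; ring
  have c2 : ∀ ω, inner ℝ (X 0 ω) t + inner ℝ (Y 0 ω) s - (inner ℝ (X 1 ω) t + inner ℝ (Y 2 ω) s)
      = inner ℝ (X 0 ω - X 1 ω) t + inner ℝ (Y 0 ω - Y 2 ω) s := fun ω => by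
    simp only [inner_sub_left]; ring
  simp only [c1] at eA
  simp only [c2] at eAM
  rw [eA]
  simp only [inner_sub_left] at eAM ⊢
  rw [← eAM]
  ring

theorem integral_cos_add_add_integral_cos_neg_add [IsProbabilityMeasure P] {a b : Ω → ℝ}
    (ha : Measurable a) (hb : Measurable b) :
    ∫ ω, Real.cos (a ω + b ω) ∂P + ∫ ω, Real.cos (-a ω + b ω) ∂P
      = 2 * (1 - ∫ ω, (1 - Real.cos (a ω)) ∂P - ∫ ω, (1 - Real.cos (b ω)) ∂P
        + ∫ ω, (1 - Real.cos (a ω)) * (1 - Real.cos (b ω)) ∂P) := by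
  have hi : ∀ {f : Ω → ℝ}, Measurable f → Integrable (fun ω => Real.cos (f ω)) P := fun hf =>
    Integrable.of_bound (by fun_prop) 1 (ae_of_all _ fun ω => Real.abs_cos_le_one _)
  have i1 := hi (ha.add hb)
  have hna : Measurable fun ω => -a ω := ha.neg
  have i2 := hi (hna.add hb)
  have ia : Integrable (fun ω => 1 - Real.cos (a ω)) P := (integrable_const 1).sub (hi ha)
  have ib : Integrable (fun ω => 1 - Real.cos (b ω)) P := (integrable_const 1).sub (hi hb)
  have iab : Integrable (fun ω => (1 - Real.cos (a ω)) * (1 - Real.cos (b ω))) P := by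
    refine Integrable.of_bound (by fun_prop) 4 (ae_of_all _ fun ω => ?_)
    rw [norm_mul, Real.norm_eq_abs, Real.norm_eq_abs,
      abs_of_nonneg (sub_nonneg.2 (Real.cos_le_one _)),
      abs_of_nonneg (sub_nonneg.2 (Real.cos_le_one _))]
    nlinarith [Real.cos_le_one (a ω), Real.cos_le_one (b ω), Real.neg_one_le_cos (a ω),
      Real.neg_one_le_cos (b ω)]
  have e : ∀ ω, Real.cos (a ω + b ω) + Real.cos (-a ω + b ω)
      = 2 * (1 - (1 - Real.cos (a ω)) - (1 - Real.cos (b ω))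
        + (1 - Real.cos (a ω)) * (1 - Real.cos (b ω))) := fun ω => by
    rw [Real.cos_add, Real.cos_add, Real.cos_neg, Real.sin_neg]; ring
  have j1 : Integrable (fun ω => 1 - (1 - Real.cos (a ω))) P := (integrable_const 1).sub ia
  have j2 : Integrable (fun ω => 1 - (1 - Real.cos (a ω)) - (1 - Real.cos (b ω))) P := j1.sub ib
  have := integral_add i1 i2
  simp only [Pi.add_apply] at this
  rw [← this, integral_congr_ae (ae_of_all _ e), integral_const_mul, integral_add j2 iab,
    integral_sub j1 ib, integral_sub (integrable_const 1) ia]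
  simp

/-- Adding the values at `t` and `-t` removes the sines, and in the remaining products of cosines,
expanded in `1 - cos`, the terms of degree zero and one cancel. Each term that is left is an
expectation of nonnegative kernels, so that it can be integrated by Tonelli's theorem. -/
theorem dcovDensity_add_neg [IsProbabilityMeasure P] (h : IIDPairs P X Y) (t : E) (s : F) :
    dcovDensity P (X 0) (Y 0) (t, s) + dcovDensity P (X 0) (Y 0) (-t, s)
      = 2 * (∫ ω, cosKernel t (X 0 ω - X 1 ω) * cosKernel s (Y 0 ω - Y 1 ω) ∂P
        - 2 * ∫ ω, cosKernel t (X 0 ω - X 1 ω) * cosKernel s (Y 0 ω - Y 2 ω) ∂P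
        + (∫ ω, cosKernel t (X 0 ω - X 1 ω) ∂P) * ∫ ω, cosKernel s (Y 0 ω - Y 1 ω) ∂P) := by
  have hX := h.measurable_fst
  have hY := h.measurable_snd
  have ma : ∀ k, Measurable fun ω => inner ℝ (X 0 ω - X k ω) t := fun k =>
    ((hX 0).sub (hX k)).inner measurable_const
  have mb : ∀ k, Measurable fun ω => inner ℝ (Y 0 ω - Y k ω) s := fun k =>
    ((hY 0).sub (hY k)).inner measurable_const
  have hb : ∫ ω, (1 - Real.cos (inner ℝ (Y 0 ω - Y 2 ω) s)) ∂P
      = ∫ ω, (1 - Real.cos (inner ℝ (Y 0 ω - Y 1 ω) s)) ∂P :=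
    h.integral_perm (Equiv.swap 1 2)
      (g := fun q => 1 - Real.cos (inner ℝ ((q 0).2 - (q 1).2) s)) (by fun_prop)
  have hcos : ∀ {f : Ω → ℝ}, Measurable f →
      ∫ ω, Real.cos (f ω) ∂P = 1 - ∫ ω, (1 - Real.cos (f ω)) ∂P := fun hf => by
    rw [integral_sub (integrable_const 1) (Integrable.of_bound (by fun_prop) 1
      (ae_of_all _ fun ω => Real.abs_cos_le_one _))]
    simp
  have k1 := integral_cos_add_add_integral_cos_neg_add (P := P) (ma 1) (mb 1)
  have k2 := integral_cos_add_add_integral_cos_neg_add (P := P) (ma 1) (mb 2)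
  have e1 := hcos (ma 1)
  have e2 := hcos (mb 1)
  have hs := sq_norm_chr_sub h t s
  have hs' := sq_norm_chr_sub h (-t) s
  simp only [inner_neg_right, Real.cos_neg] at hs'
  simp only [dcovDensity, cosKernel, norm_neg, inner_neg_right, div_mul_div_comm, integral_div]
  rw [hs, hs', e1, e2]
  rw [hb] at k2
  generalize (‖t‖ ^ 2) ^ ((Module.finrank ℝ E : ℝ) / 2 + 1 / 2)
    * (‖s‖ ^ 2) ^ ((Module.finrank ℝ F : ℝ) / 2 + 1 / 2) = w
  linear_combination (k1 - 2 * k2) / w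

/-- The bound by a product of a function of `t` and a function of `s`, both integrable as soon as
`X` and `Y` have first moments. -/
theorem dcovDensity_le [IsProbabilityMeasure P] (h : IIDPairs P X Y) (p : E × F) :
    dcovDensity P (X 0) (Y 0) p
      ≤ (∫ ω, cosKernel p.1 (X 0 ω - X 1 ω) ∂P) * ∫ ω, cosKernel p.2 (Y 0 ω - Y 1 ω) ∂P := by
  have hX := h.measurable_fst
  have hY := h.measurable_snd
  have hf : Measurable fun q : E × F => inner ℝ q.1 p.1 := by fun_prop
  have hg : Measurable fun q : E × F => inner ℝ q.2 p.2 := by fun_prop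
  have h01 : IndepFun (fun ω => (X 0 ω, Y 0 ω)) (fun ω => (X 1 ω, Y 1 ω)) P :=
    h.indep.indepFun (by decide)
  have mf : ∀ k, Measurable fun ω => inner ℝ (X k ω) p.1 := fun k =>
    (hX k).inner measurable_const
  have mg : ∀ k, Measurable fun ω => inner ℝ (Y k ω) p.2 := fun k =>
    (hY k).inner measurable_const
  have hcos : ∀ {f g : Ω → ℝ}, Measurable f → Measurable g →
      1 - ∫ ω, Real.cos (f ω - g ω) ∂P = ∫ ω, (1 - Real.cos (f ω - g ω)) ∂P := fun hf hg => by
    rw [integral_sub (integrable_const 1) (Integrable.of_bound (by fun_prop) 1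
      (ae_of_all _ fun ω => Real.abs_cos_le_one _))]
    simp
  have hle := sq_norm_chr_add_sub_le (P := P) (mf 0) (mg 0)
  rw [sq_norm_chr (mf 0) (mf 1) (h01.comp hf hf) ((h.ident 1).comp hf),
    sq_norm_chr (mg 0) (mg 1) (h01.comp hg hg) ((h.ident 1).comp hg),
    hcos (mf 0) (mf 1), hcos (mg 0) (mg 1)] at hle
  simp only [dcovDensity, cosKernel, integral_div, div_mul_div_comm, inner_sub_left]
  exact div_le_div_of_nonneg_right hle (by positivity)

theorem integral_integral_cosKernel [SFinite P] {U : Ω → E} (hU : Measurable U)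
    (hi : Integrable (fun ω => ‖U ω‖) P) :
    Integrable (fun t : E => ∫ ω, cosKernel t (U ω) ∂P) ∧
      ∫ t : E, ∫ ω, cosKernel t (U ω) ∂P
        = kernelConst (Module.finrank ℝ E) * ∫ ω, ‖U ω‖ ∂P := by
  rw [← integral_const_mul]
  exact integrable_integral_of_nonneg (f := fun q : E × Ω => cosKernel q.1 (U q.2))
    (measurable_cosKernel (by fun_prop) (by fun_prop))
    (ae_of_all _ fun ω => ae_of_all _ fun t => cosKernel_nonneg _ _)
    (ae_of_all _ fun ω => (integral_cosKernel (U ω)).1)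
    (ae_of_all _ fun ω => (integral_cosKernel (U ω)).2) (hi.const_mul _)

theorem integral_integral_cosKernel_mul [SFinite P] {U : Ω → E} {V : Ω → F} (hU : Measurable U)
    (hV : Measurable V) (hi : Integrable (fun ω => ‖U ω‖ * ‖V ω‖) P) :
    Integrable (fun p : E × F => ∫ ω, cosKernel p.1 (U ω) * cosKernel p.2 (V ω) ∂P) ∧
      ∫ p : E × F, ∫ ω, cosKernel p.1 (U ω) * cosKernel p.2 (V ω) ∂P
        = kernelConst (Module.finrank ℝ E) * kernelConst (Module.finrank ℝ F)
          * ∫ ω, ‖U ω‖ * ‖V ω‖ ∂P := by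
  rw [← integral_const_mul]
  refine integrable_integral_of_nonneg
    (f := fun q : (E × F) × Ω => cosKernel q.1.1 (U q.2) * cosKernel q.1.2 (V q.2))
    ((measurable_cosKernel (by fun_prop) (by fun_prop)).mul
      (measurable_cosKernel (by fun_prop) (by fun_prop)))
    (ae_of_all _ fun ω => ae_of_all _ fun t =>
      mul_nonneg (cosKernel_nonneg _ _) (cosKernel_nonneg _ _))
    (ae_of_all _ fun ω => (integral_cosKernel (U ω)).1.mul_prod (integral_cosKernel (V ω)).1)
    (ae_of_all _ fun ω => ?_) (hi.const_mul _)
  dsimp only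
  rw [Measure.volume_eq_prod, integral_prod_mul (fun t => cosKernel t (U ω))
    (fun t => cosKernel t (V ω)), (integral_cosKernel (U ω)).2, (integral_cosKernel (V ω)).2]
  ring

end

/-! ### Integrating the density -/

section

variable {Ω : Type*} [MeasurableSpace Ω] {P : Measure Ω}
  {E : Type*} [NormedAddCommGroup E] [InnerProductSpace ℝ E] [FiniteDimensional ℝ E]
  [MeasurableSpace E] [BorelSpace E]
  {F : Type*} [NormedAddCommGroup F] [InnerProductSpace ℝ F] [FiniteDimensional ℝ F]
  [MeasurableSpace F] [BorelSpace F]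
  {X : Fin 3 → Ω → E} {Y : Fin 3 → Ω → F}

/-- Products with equal indices are controlled by the mixed moment, those with different indices
by independence and the first moments. -/
theorem IIDPairs.integrable_norm_sub_mul_norm_sub (h : IIDPairs P X Y)
    (hX : Integrable (fun ω => ‖X 0 ω‖) P) (hY : Integrable (fun ω => ‖Y 0 ω‖) P)
    (hXY : Integrable (fun ω => ‖X 0 ω‖ * ‖Y 0 ω‖) P) (i j k l : Fin 3) :
    Integrable (fun ω => ‖X i ω - X j ω‖ * ‖Y k ω - Y l ω‖) P := by
  have mX := h.measurable_fst
  have mY := h.measurable_snd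
  have mf : Measurable fun q : E × F => ‖q.1‖ := by fun_prop
  have mg : Measurable fun q : E × F => ‖q.2‖ := by fun_prop
  have key : ∀ a b, Integrable (fun ω => ‖X a ω‖ * ‖Y b ω‖) P := by
    intro a b
    rcases eq_or_ne a b with rfl | hab
    · exact ((h.ident a).comp (u := fun q : E × F => ‖q.1‖ * ‖q.2‖)
        (by fun_prop)).integrable_iff.2 hXY
    · exact ((h.indep.indepFun hab).comp mf mg).integrable_mul
        (((h.ident a).comp mf).integrable_iff.2 hX) (((h.ident b).comp mg).integrable_iff.2 hY)
  refine (((key i k).add (key i l)).add ((key j k).add (key j l))).mono'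
    (by fun_prop) (ae_of_all _ fun ω => ?_)
  rw [norm_mul, norm_norm, norm_norm]
  calc ‖X i ω - X j ω‖ * ‖Y k ω - Y l ω‖
      ≤ (‖X i ω‖ + ‖X j ω‖) * (‖Y k ω‖ + ‖Y l ω‖) :=
        mul_le_mul (norm_sub_le _ _) (norm_sub_le _ _) (norm_nonneg _) (by positivity)
    _ = _ := by simp only [Pi.add_apply]; ring

theorem stronglyMeasurable_chr [SFinite P] {α : Type*} [MeasurableSpace α] {f : α → Ω → ℝ}
    (hf : Measurable fun q : α × Ω => f q.1 q.2) : StronglyMeasurable fun a => chr P (f a) := by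
  have : Measurable fun q : α × Ω => Complex.exp (Complex.I * (f q.1 q.2 : ℂ)) := by fun_prop
  exact this.stronglyMeasurable.integral_prod_right

theorem measurable_dcovDensity [SFinite P] {U : Ω → E} {V : Ω → F} (hU : Measurable U)
    (hV : Measurable V) : Measurable (dcovDensity P U V) := by
  have h1 : Measurable fun p : E × F => chr P (fun ω => inner ℝ (U ω) p.1 + inner ℝ (V ω) p.2) :=
    (stronglyMeasurable_chr (by fun_prop)).measurable
  have h2 : Measurable fun p : E × F => chr P (fun ω => inner ℝ (U ω) p.1) :=
    (stronglyMeasurable_chr (by fun_prop)).measurable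
  have h3 : Measurable fun p : E × F => chr P (fun ω => inner ℝ (V ω) p.2) :=
    (stronglyMeasurable_chr (by fun_prop)).measurable
  unfold dcovDensity
  fun_prop

/-- First moments suffice for the integral to converge; no mixed moment is needed. -/
theorem integrable_dcovDensity [IsProbabilityMeasure P] (h : IIDPairs P X Y)
    (hX : Integrable (fun ω => ‖X 0 ω‖) P) (hY : Integrable (fun ω => ‖Y 0 ω‖) P) :
    Integrable (dcovDensity P (X 0) (Y 0)) := by
  have mX := h.measurable_fst
  have mY := h.measurable_snd
  have iX := integral_integral_cosKernel ((mX 0).sub (mX 1)) (h.integrable_norm_sub_fst hX 0 1)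
  have iY := integral_integral_cosKernel ((mY 0).sub (mY 1)) (h.swap.integrable_norm_sub_fst hY 0 1)
  refine (iX.1.mul_prod iY.1).mono' (measurable_dcovDensity (mX 0) (mY 0)).aestronglyMeasurable
    (ae_of_all _ fun p => ?_)
  rw [Real.norm_of_nonneg (dcovDensity_nonneg _ _ _)]
  exact dcovDensity_le h p

theorem integral_dcovDensity [IsProbabilityMeasure P] (h : IIDPairs P X Y)
    (hX : Integrable (fun ω => ‖X 0 ω‖) P) (hY : Integrable (fun ω => ‖Y 0 ω‖) P)
    (hXY : Integrable (fun ω => ‖X 0 ω‖ * ‖Y 0 ω‖) P) :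
    ∫ p, dcovDensity P (X 0) (Y 0) p
      = kernelConst (Module.finrank ℝ E) * kernelConst (Module.finrank ℝ F)
        * (∫ ω, ‖X 0 ω - X 1 ω‖ * ‖Y 0 ω - Y 1 ω‖ ∂P
          - 2 * ∫ ω, ‖X 0 ω - X 1 ω‖ * ‖Y 0 ω - Y 2 ω‖ ∂P
          + (∫ ω, ‖X 0 ω - X 1 ω‖ ∂P) * ∫ ω, ‖Y 0 ω - Y 1 ω‖ ∂P) := by
  have mX := h.measurable_fst
  have mY := h.measurable_snd
  have dX : Measurable fun ω => X 0 ω - X 1 ω := (mX 0).sub (mX 1)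
  have dY : ∀ k, Measurable fun ω => Y 0 ω - Y k ω := fun k => (mY 0).sub (mY k)
  obtain ⟨iX, vX⟩ :=
    integral_integral_cosKernel dX (h.integrable_norm_sub_fst hX 0 1)
  obtain ⟨iY, vY⟩ :=
    integral_integral_cosKernel (dY 1) (h.swap.integrable_norm_sub_fst hY 0 1)
  obtain ⟨i1, v1⟩ := integral_integral_cosKernel_mul dX (dY 1)
    (h.integrable_norm_sub_mul_norm_sub hX hY hXY 0 1 0 1)
  obtain ⟨i2, v2⟩ := integral_integral_cosKernel_mul dX (dY 2)
    (h.integrable_norm_sub_mul_norm_sub hX hY hXY 0 1 0 2)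
  -- The reflection `t ↦ -t` preserves the integral of the density, so half of the sum of the
  -- density and its reflection has the same integral.
  have hneg : MeasurePreserving (fun p : E × F => (-p.1, p.2)) volume volume :=
    (Measure.measurePreserving_neg (volume : Measure E)).prod
      (MeasurePreserving.id (volume : Measure F))
  have hemb : MeasurableEmbedding (fun p : E × F => (-p.1, p.2)) :=
    ((MeasurableEquiv.neg E).prodCongr (MeasurableEquiv.refl F)).measurableEmbedding
  have i0 := integrable_dcovDensity h hX hY
  have i0' : Integrable fun p : E × F => dcovDensity P (X 0) (Y 0) (-p.1, p.2) :=
    (hneg.integrable_comp_emb hemb).2 i0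
  have v0 := hneg.integral_comp hemb (dcovDensity P (X 0) (Y 0))
  have hsum := integral_congr_ae (μ := (volume : Measure (E × F)))
    (ae_of_all _ fun p : E × F => dcovDensity_add_neg h p.1 p.2)
  have i12 : Integrable fun p : E × F =>
      ∫ ω, cosKernel p.1 (X 0 ω - X 1 ω) * cosKernel p.2 (Y 0 ω - Y 1 ω) ∂P
        - 2 * ∫ ω, cosKernel p.1 (X 0 ω - X 1 ω) * cosKernel p.2 (Y 0 ω - Y 2 ω) ∂P :=
    i1.sub (i2.const_mul 2)
  have i3 := iX.mul_prod iY
  have v3 := integral_prod_mul (μ := (volume : Measure E)) (ν := (volume : Measure F))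
    (fun t => ∫ ω, cosKernel t (X 0 ω - X 1 ω) ∂P) (fun s => ∫ ω, cosKernel s (Y 0 ω - Y 1 ω) ∂P)
  rw [← Measure.volume_eq_prod, vX, vY] at v3
  rw [integral_add i0 i0', v0, integral_const_mul, integral_add i12 i3,
    integral_sub i1 (i2.const_mul 2), integral_const_mul, v1, v2, v3] at hsum
  linear_combination hsum / 2

/-- By Fubini, `‖U - v‖ ^ 2` is integrable for some fixed value `v` of `V`. -/
theorem memLp_two_of_indepFun_sub [IsProbabilityMeasure P] {U V : Ω → E} (hU : Measurable U)
    (hV : Measurable V) (h : IndepFun U V P) (hi : Integrable (fun ω => ‖U ω - V ω‖ ^ 2) P) :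
    MemLp U 2 P := by
  -- Pass to the product of the laws of `U` and `V`, where Fubini applies.
  have hmap := (indepFun_iff_map_prod_eq_prod_map_map hU.aemeasurable hV.aemeasurable).1 h
  have := Measure.isProbabilityMeasure_map (μ := P) hU.aemeasurable
  have := Measure.isProbabilityMeasure_map (μ := P) hV.aemeasurable
  have hi' : Integrable (fun q : E × E => ‖q.1 - q.2‖ ^ 2) ((P.map U).prod (P.map V)) := by
    rw [← hmap, integrable_map_measure (by fun_prop) (by fun_prop)]
    exact hi
  obtain ⟨v, hv⟩ := hi'.prod_left_ae.exists
  have h2 : MemLp (fun u : E => u - v) 2 (P.map U) :=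
    (memLp_two_iff_integrable_sq_norm (by fun_prop)).2 hv
  have h3 : MemLp (fun u : E => u) 2 (P.map U) :=
    (h2.add (memLp_const v)).ae_eq (ae_of_all _ fun u => by simp)
  exact (memLp_map_measure_iff (by fun_prop) hU.aemeasurable).1 h3

end

/-! ### The two representations and the expansion of the distance covariance -/

theorem eDist_eq_norm {Ω : Type*} {n : ℕ} (V V' : Ω → EuclideanSpace ℝ (Fin n)) (ω : Ω) :
    eDist V V' ω = ‖V ω - V' ω‖ := by
  simp [eDist, EuclideanSpace.norm_eq]

section

variable {Ω : Type*} [MeasurableSpace Ω] {P : Measure Ω} {n : ℕ}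

theorem dCovIntegrand_eq_dcovDensity (U : Ω → ℝ) (V : Ω → EuclideanSpace ℝ (Fin n)) :
    dCovIntegrand P U V = dcovDensity P U V := by
  ext p
  have h1 : ∀ ω, inner ℝ (U ω) p.1 = p.1 * U ω := fun ω => by simp
  have h2 : ∀ ω, inner ℝ (V ω) p.2 = ∑ j, p.2 j * V ω j := fun ω => by simp [PiLp.inner_apply]
  simp only [dCovIntegrand, dcovDensity, chr, h1, h2, ← EuclideanSpace.real_norm_sq_eq]
  norm_num

/-- The normalization of `dCov` is `1 / (c₁ cₙ)`. -/
theorem dCov_normalization_mul_kernelConst (n : ℕ) :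
    Real.Gamma ((n : ℝ) / 2 + 1 / 2) / Real.pi ^ ((n : ℝ) / 2 + 3 / 2)
      * (kernelConst 1 * kernelConst n) = 1 := by
  have h1 : Real.Gamma ((n : ℝ) / 2 + 1 / 2) ≠ 0 :=
    (Real.Gamma_pos_of_pos (by positivity)).ne'
  have h2 : kernelConst 1 = Real.pi := by
    simp only [kernelConst]; norm_num [Real.Gamma_one]
  have h3 : Real.pi ^ ((n : ℝ) / 2 + 3 / 2) = Real.pi * Real.pi ^ ((n : ℝ) / 2 + 1 / 2) := by
    rw [← Real.rpow_one_add' (by positivity) (by positivity)]; congr 1; ring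
  rw [h2, h3, kernelConst]
  have : Real.pi ^ ((n : ℝ) / 2 + 1 / 2) ≠ 0 := by positivity
  field_simp

variable {Z : Fin 3 → Ω → ℝ} {W : Fin 3 → Ω → EuclideanSpace ℝ (Fin n)}

theorem integrable_dCovIntegrand_and_dCov_nonneg [IsProbabilityMeasure P] (h : IIDPairs P Z W)
    (hZ : Integrable (fun ω => ‖Z 0 ω‖) P) (hW : Integrable (fun ω => ‖W 0 ω‖) P) :
    Integrable (dCovIntegrand P (Z 0) (W 0)) ∧ 0 ≤ dCov P (Z 0) (W 0) := by
  rw [dCov, dCovIntegrand_eq_dcovDensity]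
  refine ⟨integrable_dcovDensity h hZ hW, mul_nonneg ?_ ?_⟩
  · exact div_nonneg (Real.Gamma_nonneg_of_nonneg (by positivity)) (by positivity)
  · exact integral_nonneg fun p => dcovDensity_nonneg _ _ p

/-- The distance covariance in terms of the distances between independent copies. -/
theorem dCov_eq [IsProbabilityMeasure P] (h : IIDPairs P Z W)
    (hZ : Integrable (fun ω => ‖Z 0 ω‖) P) (hW : Integrable (fun ω => ‖W 0 ω‖) P)
    (hZW : Integrable (fun ω => ‖Z 0 ω‖ * ‖W 0 ω‖) P) :
    dCov P (Z 0) (W 0)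
      = ∫ ω, ‖Z 0 ω - Z 1 ω‖ * ‖W 0 ω - W 1 ω‖ ∂P
          - 2 * ∫ ω, ‖Z 0 ω - Z 1 ω‖ * ‖W 0 ω - W 2 ω‖ ∂P
          + (∫ ω, ‖Z 0 ω - Z 1 ω‖ ∂P) * ∫ ω, ‖W 0 ω - W 1 ω‖ ∂P := by
  rw [dCov, dCovIntegrand_eq_dcovDensity, integral_dcovDensity h hZ hW hZW, ← mul_assoc,
    Module.finrank_self, finrank_euclideanSpace_fin, dCov_normalization_mul_kernelConst, one_mul]

/-- Exchanging the copies `1` and `2` in the middle term of `dCov_eq` makes `‖W 0 - W 1‖` a common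
factor. -/
theorem dCov_eq_integral_eDist_mul_Rstat [IsProbabilityMeasure P] (h : IIDPairs P Z W)
    (hZ : Integrable (fun ω => ‖Z 0 ω‖) P) (hW : Integrable (fun ω => ‖W 0 ω‖) P)
    (hZW : Integrable (fun ω => ‖Z 0 ω‖ * ‖W 0 ω‖) P) :
    Integrable (fun ω => eDist (W 0) (W 1) ω * Rstat P (Z 0) (Z 1) (Z 2) ω) P ∧
      dCov P (Z 0) (W 0) = ∫ ω, eDist (W 0) (W 1) ω * Rstat P (Z 0) (Z 1) (Z 2) ω ∂P := by
  have i1 := h.integrable_norm_sub_mul_norm_sub hZ hW hZW 0 1 0 1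
  have i2 := (h.integrable_norm_sub_mul_norm_sub hZ hW hZW 0 2 0 1).const_mul 2
  have i3 := (h.swap.integrable_norm_sub_fst hW 0 1).const_mul (∫ ω, ‖Z 0 ω - Z 1 ω‖ ∂P)
  have hswap : ∫ ω, ‖Z 0 ω - Z 2 ω‖ * ‖W 0 ω - W 1 ω‖ ∂P
      = ∫ ω, ‖Z 0 ω - Z 1 ω‖ * ‖W 0 ω - W 2 ω‖ ∂P :=
    h.integral_perm (Equiv.swap 1 2)
      (g := fun q => ‖(q 0).1 - (q 1).1‖ * ‖(q 0).2 - (q 2).2‖) (by fun_prop)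
  have e : (fun ω => eDist (W 0) (W 1) ω * Rstat P (Z 0) (Z 1) (Z 2) ω)
      = fun ω => ‖Z 0 ω - Z 1 ω‖ * ‖W 0 ω - W 1 ω‖ - 2 * (‖Z 0 ω - Z 2 ω‖ * ‖W 0 ω - W 1 ω‖)
        + (∫ ω, ‖Z 0 ω - Z 1 ω‖ ∂P) * ‖W 0 ω - W 1 ω‖ := by
    ext ω
    simp only [eDist_eq_norm, Rstat, Real.norm_eq_abs]
    ring
  have i12 : Integrable (fun ω => ‖Z 0 ω - Z 1 ω‖ * ‖W 0 ω - W 1 ω‖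
      - 2 * (‖Z 0 ω - Z 2 ω‖ * ‖W 0 ω - W 1 ω‖)) P := i1.sub i2
  rw [e]
  refine ⟨i12.add i3, ?_⟩
  rw [integral_add i12 i3, integral_sub i1 i2, integral_const_mul, integral_const_mul, hswap,
    dCov_eq h hZ hW hZW]

theorem dCov_eq_integral_add [IsProbabilityMeasure P] (h : IIDPairs P Z W)
    (hZ : Integrable (fun ω => ‖Z 0 ω‖) P) (hW : Integrable (fun ω => ‖W 0 ω‖) P)
    (hZW : Integrable (fun ω => ‖Z 0 ω‖ * ‖W 0 ω‖) P) :
    Integrable (fun ω => |Z 0 ω - Z 1 ω|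
        * (1 * eDist (W 0) (W 1) ω + (-2) * eDist (W 0) (W 2) ω)) P ∧
      dCov P (Z 0) (W 0)
        = (∫ ω, |Z 0 ω - Z 1 ω| * (1 * eDist (W 0) (W 1) ω + (-2) * eDist (W 0) (W 2) ω) ∂P)
          + (∫ ω, |Z 0 ω - Z 1 ω| ∂P) * ∫ ω, eDist (W 0) (W 1) ω ∂P := by
  have i1 := h.integrable_norm_sub_mul_norm_sub hZ hW hZW 0 1 0 1
  have i2 := (h.integrable_norm_sub_mul_norm_sub hZ hW hZW 0 1 0 2).const_mul 2
  have e : (fun ω => |Z 0 ω - Z 1 ω| * (1 * eDist (W 0) (W 1) ω + (-2) * eDist (W 0) (W 2) ω))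
      = fun ω => ‖Z 0 ω - Z 1 ω‖ * ‖W 0 ω - W 1 ω‖
        - 2 * (‖Z 0 ω - Z 1 ω‖ * ‖W 0 ω - W 2 ω‖) := by
    ext ω
    simp only [eDist_eq_norm, Real.norm_eq_abs]
    ring
  rw [e]
  refine ⟨i1.sub i2, ?_⟩
  rw [integral_sub i1 i2, integral_const_mul, dCov_eq h hZ hW hZW]
  simp only [eDist_eq_norm, Real.norm_eq_abs]

/-- The Taylor remainder of the square root, on its whole domain `x ≥ -κ`. With `a = √κ` and
`y = √(κ + x)` it equals `(y - a) ^ 3 (y + 3 a) / (8 a ^ 3)`, while `x = (y - a) (y + a)`. -/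
theorem abs_sqrt_sub_taylor_le {κ x : ℝ} (hκ : 0 < κ) (hx : 0 ≤ κ + x) :
    |√(κ + x) - √κ - (x / (2 * κ ^ (1 / 2 : ℝ)) - x ^ 2 / (8 * κ ^ (3 / 2 : ℝ)))|
      ≤ |x| ^ 3 / √κ ^ 5 := by
  set a := √κ with ha
  set y := √(κ + x) with hy
  have ha0 : 0 < a := Real.sqrt_pos.2 hκ
  have hy0 : 0 ≤ y := Real.sqrt_nonneg _
  have e1 : κ ^ (1 / 2 : ℝ) = a := (Real.sqrt_eq_rpow κ).symm
  have e3 : κ ^ (3 / 2 : ℝ) = a ^ 3 := by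
    rw [← e1, ← Real.rpow_natCast, ← Real.rpow_mul hκ.le]; norm_num
  have ex : x = (y - a) * (y + a) := by
    have h1 : a ^ 2 = κ := Real.sq_sqrt hκ.le
    have h2 : y ^ 2 = κ + x := Real.sq_sqrt hx
    linear_combination h1 - h2
  have key : y - a - (x / (2 * a) - x ^ 2 / (8 * a ^ 3))
      = (y - a) ^ 3 * ((y + 3 * a) / (8 * a ^ 3)) := by
    rw [ex]; field_simp; ring
  rw [e1, e3, key, ex, abs_mul, abs_mul, abs_pow, mul_pow, mul_div_assoc,
    abs_of_nonneg (by positivity : 0 ≤ y + a),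
    abs_of_nonneg (by positivity : 0 ≤ (y + 3 * a) / (8 * a ^ 3))]
  refine mul_le_mul_of_nonneg_left ?_ (by positivity)
  rw [div_le_div_iff₀ (by positivity) (by positivity)]
  have : (y + 3 * a) * a ^ 2 ≤ (y + a) ^ 3 * 8 := by
    nlinarith [mul_nonneg hy0 (sq_nonneg a), pow_nonneg hy0 3, mul_nonneg (sq_nonneg y) ha0.le,
      pow_pos ha0 3]
  nlinarith [mul_le_mul_of_nonneg_left this (pow_nonneg ha0.le 3)]

theorem sq_norm_sub_eq_mul_kap_add_Del (hn : n ≠ 0) (V V' : Ω → EuclideanSpace ℝ (Fin n)) (ω : Ω) :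
    ‖V ω - V' ω‖ ^ 2 = n * (kap P V + Del P V V' ω) := by
  have hn' : (n : ℝ) ≠ 0 := by exact_mod_cast hn
  rw [EuclideanSpace.real_norm_sq_eq, Del]
  simp only [PiLp.sub_apply]
  field_simp
  ring

theorem measurable_Del {V V' : Ω → EuclideanSpace ℝ (Fin n)} (hV : Measurable V)
    (hV' : Measurable V') : Measurable (Del P V V') := by
  unfold Del
  fun_prop

theorem memLp_two_of_integrable_pow_six [IsFiniteMeasure P] {f : Ω → ℝ} (hf : Measurable f)
    (h : Integrable (fun ω => |f ω| ^ 6) P) :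
    MemLp f 2 P ∧ MemLp (fun ω => f ω ^ 2) 2 P ∧ MemLp (fun ω => |f ω| ^ 3) 2 P := by
  have hpow : ∀ k ≤ 6, Integrable (fun ω => |f ω| ^ k) P := fun k hk => by
    refine ((integrable_const 1).add h).mono' (by fun_prop) (ae_of_all _ fun ω => ?_)
    rw [Real.norm_of_nonneg (by positivity)]
    rcases le_total (|f ω|) 1 with h1 | h1
    · exact (pow_le_one₀ (abs_nonneg _) h1).trans (le_add_of_nonneg_right (by positivity))
    · exact (pow_le_pow_right₀ h1 hk).trans (le_add_of_nonneg_left zero_le_one)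
  refine ⟨(memLp_two_iff_integrable_sq (by fun_prop)).2 ?_,
    (memLp_two_iff_integrable_sq (by fun_prop)).2 ?_,
    (memLp_two_iff_integrable_sq (by fun_prop)).2 ?_⟩
  · simpa only [sq_abs] using hpow 2 (by norm_num)
  · refine (hpow 4 (by norm_num)).congr (ae_of_all _ fun ω => ?_)
    change |f ω| ^ 4 = (f ω ^ 2) ^ 2
    rw [← sq_abs (f ω), ← pow_mul]
  · refine h.congr (ae_of_all _ fun ω => ?_)
    exact pow_mul |f ω| 3 2

/-- `R` is centered, and its second moment is controlled by that of `Z 0 - Z 1`. -/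
theorem memLp_Rstat [IsProbabilityMeasure P] (h : IIDPairs P Z W) (hZ2 : MemLp (Z 0) 2 P) :
    MemLp (Rstat P (Z 0) (Z 1) (Z 2)) 2 P ∧ ∫ ω, Rstat P (Z 0) (Z 1) (Z 2) ω ∂P = 0 ∧
      ∫ ω, Rstat P (Z 0) (Z 1) (Z 2) ω ^ 2 ∂P ≤ 18 * ∫ ω, |Z 0 ω - Z 1 ω| ^ 2 ∂P := by
  have mZ := h.measurable_fst
  have hZ : ∀ k, MemLp (Z k) 2 P := fun k =>
    ((h.ident k).comp measurable_fst).memLp_iff.2 hZ2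
  have hd : ∀ k, MemLp (fun ω => |Z 0 ω - Z k ω|) 2 P := fun k =>
    ((hZ 0).sub (hZ k)).abs
  have hdi : ∀ k, Integrable (fun ω => |Z 0 ω - Z k ω|) P := fun k =>
    (hd k).integrable (by norm_num)
  have i2 : ∀ k, Integrable (fun ω => |Z 0 ω - Z k ω| ^ 2) P := fun k => (hd k).integrable_sq
  set m := ∫ ω, |Z 0 ω - Z 1 ω| ∂P with hm
  have e1 : ∫ ω, |Z 0 ω - Z 2 ω| ∂P = m :=
    h.integral_perm (Equiv.swap 1 2) (g := fun q => |(q 0).1 - (q 1).1|) (by fun_prop)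
  have e2 : ∫ ω, |Z 0 ω - Z 2 ω| ^ 2 ∂P = ∫ ω, |Z 0 ω - Z 1 ω| ^ 2 ∂P :=
    h.integral_perm (Equiv.swap 1 2) (g := fun q => |(q 0).1 - (q 1).1| ^ 2) (by fun_prop)
  have hR : Rstat P (Z 0) (Z 1) (Z 2)
      = fun ω => |Z 0 ω - Z 1 ω| - 2 * |Z 0 ω - Z 2 ω| + m := by
    ext ω; simp only [Rstat, hm]; ring
  have hmem : MemLp (Rstat P (Z 0) (Z 1) (Z 2)) 2 P := by
    rw [hR]
    exact ((hd 1).sub ((hd 2).const_mul 2)).add (memLp_const m)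
  have j : Integrable (fun ω => |Z 0 ω - Z 1 ω| - 2 * |Z 0 ω - Z 2 ω|) P :=
    (hdi 1).sub ((hdi 2).const_mul 2)
  refine ⟨hmem, ?_, ?_⟩
  · rw [hR, integral_add j (integrable_const _), integral_sub (hdi 1) ((hdi 2).const_mul 2),
      integral_const_mul, e1]
    simp
    ring
  · have hm2 : m ^ 2 ≤ ∫ ω, |Z 0 ω - Z 1 ω| ^ 2 ∂P := by
      have := sq_integral_mul_le (hd 1) (memLp_const (1 : ℝ))
      simpa using this
    -- `(x - 2 y + m) ^ 2 ≤ 3 (x ^ 2 + 4 y ^ 2 + m ^ 2)`, whence the constant `18 = 3 (1 + 4 + 1)`.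
    have hb : ∀ ω, Rstat P (Z 0) (Z 1) (Z 2) ω ^ 2
        ≤ 3 * |Z 0 ω - Z 1 ω| ^ 2 + 12 * |Z 0 ω - Z 2 ω| ^ 2 + 3 * m ^ 2 := by
      intro ω
      rw [hR]
      nlinarith [sq_nonneg (|Z 0 ω - Z 1 ω| + 2 * |Z 0 ω - Z 2 ω|),
        sq_nonneg (|Z 0 ω - Z 1 ω| - m), sq_nonneg (2 * |Z 0 ω - Z 2 ω| + m)]
    have j1 : Integrable (fun ω => 3 * |Z 0 ω - Z 1 ω| ^ 2 + 12 * |Z 0 ω - Z 2 ω| ^ 2) P :=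
      ((i2 1).const_mul 3).add ((i2 2).const_mul 12)
    refine (integral_mono hmem.integrable_sq (j1.add (integrable_const (3 * m ^ 2))) hb).trans ?_
    simp only [Pi.add_apply]
    rw [integral_add j1 (integrable_const _),
      integral_add ((i2 1).const_mul 3) ((i2 2).const_mul 12), integral_const_mul,
      integral_const_mul, e2]
    simp only [integral_const, probReal_univ, one_smul]
    linarith

theorem integrable_mainTerm [IsProbabilityMeasure P] (h : IIDPairs P Z W)
    (hZ2 : MemLp (Z 0) 2 P) (hΔ : Integrable (fun ω => |Del P (W 0) (W 1) ω| ^ 6) P) :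
    Integrable (mainTerm P (Z 0) (Z 1) (Z 2) (W 0) (W 1)) P := by
  obtain ⟨h1, h2, -⟩ := memLp_two_of_integrable_pow_six
    (measurable_Del (h.measurable_snd 0) (h.measurable_snd 1)) hΔ
  have := ((h1.mul_const (2 * kap P (W 0) ^ (1 / 2 : ℝ))⁻¹).sub
    (h2.mul_const (8 * kap P (W 0) ^ (3 / 2 : ℝ))⁻¹)).integrable_mul (memLp_Rstat h hZ2).1
  exact this

/-- The sixth moment of `Δ` bounds the second moment of `W 0 - W 1`, hence that of `W 0`. -/
theorem memLp_two_snd [IsProbabilityMeasure P] (h : IIDPairs P Z W) (hn : n ≠ 0)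
    (hΔ : Integrable (fun ω => |Del P (W 0) (W 1) ω| ^ 6) P) : MemLp (W 0) 2 P := by
  have mW := h.measurable_snd
  refine memLp_two_of_indepFun_sub (mW 0) (mW 1)
    ((h.indep.indepFun (show (0 : Fin 3) ≠ 1 by decide)).comp measurable_snd measurable_snd) ?_
  simp_rw [sq_norm_sub_eq_mul_kap_add_Del (P := P) hn]
  have := (memLp_two_of_integrable_pow_six (measurable_Del (mW 0) (mW 1)) hΔ).1
  exact ((integrable_const _).add (this.integrable (by norm_num))).const_mul _

/-- The expansion with an explicit constant: in `dCov = E (‖W 0 - W 1‖ R)`, with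
`‖W 0 - W 1‖ = √n √(ϰ + Δ)`, the constant Taylor term of the root contributes `√n √ϰ E R = 0`, and
the remainder is estimated by Cauchy–Schwarz. -/
theorem abs_dCov_sub_le [IsProbabilityMeasure P] (h : IIDPairs P Z W) (hn : n ≠ 0)
    (hZ2 : MemLp (Z 0) 2 P) (hΔ : Integrable (fun ω => |Del P (W 0) (W 1) ω| ^ 6) P)
    (hκ : 0 < kap P (W 0)) :
    |dCov P (Z 0) (W 0) - √n * ∫ ω, mainTerm P (Z 0) (Z 1) (Z 2) (W 0) (W 1) ω ∂P|
      ≤ √18 / √(kap P (W 0)) ^ 5 * (√n * √((∫ ω, |Del P (W 0) (W 1) ω| ^ 6 ∂P)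
        * ∫ ω, |Z 0 ω - Z 1 ω| ^ 2 ∂P)) := by
  have mW := h.measurable_snd
  have hW2 := memLp_two_snd h hn hΔ
  set κ := kap P (W 0) with hκd
  set Δ := Del P (W 0) (W 1) with hΔd
  set R := Rstat P (Z 0) (Z 1) (Z 2) with hRd
  set M := mainTerm P (Z 0) (Z 1) (Z 2) (W 0) (W 1) with hMd
  obtain ⟨hR, hR0, hR2⟩ := memLp_Rstat h hZ2
  obtain ⟨iD, vD⟩ := dCov_eq_integral_eDist_mul_Rstat h (hZ2.integrable (by norm_num)).norm
    (hW2.integrable (by norm_num)).norm (hZ2.norm.integrable_mul hW2.norm)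
  have iM : Integrable M P := integrable_mainTerm h hZ2 hΔ
  have iR : Integrable R P := hR.integrable (by norm_num)
  have h3 := (memLp_two_of_integrable_pow_six (measurable_Del (mW 0) (mW 1)) hΔ).2.2
  have hnn : (0 : ℝ) < n := by exact_mod_cast Nat.pos_of_ne_zero hn
  have hx : ∀ ω, 0 ≤ κ + Δ ω := fun ω => by
    have := sq_norm_sub_eq_mul_kap_add_Del (P := P) hn (W 0) (W 1) ω
    have h0 : 0 ≤ n * (κ + Δ ω) := by rw [← this]; positivity
    exact nonneg_of_mul_nonneg_right h0 hnn
  have hdist : ∀ ω, eDist (W 0) (W 1) ω = √n * √(κ + Δ ω) := fun ω => by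
    rw [eDist_eq_norm, ← Real.sqrt_mul hnn.le, ← sq_norm_sub_eq_mul_kap_add_Del (P := P) hn,
      Real.sqrt_sq (norm_nonneg _)]
  have iM' : Integrable (fun ω => √n * M ω) P := iM.const_mul _
  have iR' : Integrable (fun ω => √n * √κ * R ω) P := iR.const_mul _
  have iDM : Integrable (fun ω => eDist (W 0) (W 1) ω * R ω - √n * M ω) P := iD.sub iM'
  have hrem : dCov P (Z 0) (W 0) - √n * ∫ ω, M ω ∂P
      = ∫ ω, (eDist (W 0) (W 1) ω * R ω - √n * M ω - √n * √κ * R ω) ∂P := by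
    rw [integral_sub iDM iR', integral_sub iD iM', integral_const_mul, integral_const_mul, hR0, vD]
    ring
  have hpt : ∀ ω, |eDist (W 0) (W 1) ω * R ω - √n * M ω - √n * √κ * R ω|
      ≤ √n / √κ ^ 5 * (|Δ ω| ^ 3 * |R ω|) := fun ω => by
    have e : eDist (W 0) (W 1) ω * R ω - √n * M ω - √n * √κ * R ω
        = √n * ((√(κ + Δ ω) - √κ
          - (Δ ω / (2 * κ ^ (1 / 2 : ℝ)) - Δ ω ^ 2 / (8 * κ ^ (3 / 2 : ℝ)))) * R ω) := by
      rw [hdist, hMd, mainTerm]; ring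
    rw [e, abs_mul, abs_mul, abs_of_nonneg (Real.sqrt_nonneg _)]
    calc _ ≤ √n * (|Δ ω| ^ 3 / √κ ^ 5 * |R ω|) := by
          gcongr
          exact abs_sqrt_sub_taylor_le hκ (hx ω)
      _ = _ := by ring
  have iAR : Integrable (fun ω => |Δ ω| ^ 3 * |R ω|) P := h3.integrable_mul hR.abs
  have hcs := sq_integral_mul_le h3 hR.abs
  simp only [← pow_mul] at hcs
  norm_num at hcs
  have hA : 0 ≤ ∫ ω, |Δ ω| ^ 6 ∂P := integral_nonneg fun ω => by positivity
  have hB : ∫ ω, |Δ ω| ^ 3 * |R ω| ∂P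
      ≤ √18 * √((∫ ω, |Δ ω| ^ 6 ∂P) * ∫ ω, |Z 0 ω - Z 1 ω| ^ 2 ∂P) := by
    rw [← Real.sqrt_mul (by norm_num)]
    refine Real.le_sqrt_of_sq_le (hcs.trans ?_)
    calc _ ≤ (∫ ω, |Δ ω| ^ 6 ∂P) * (18 * ∫ ω, |Z 0 ω - Z 1 ω| ^ 2 ∂P) :=
          mul_le_mul_of_nonneg_left hR2 hA
      _ = _ := by ring
  rw [hrem]
  calc _ ≤ ∫ ω, |eDist (W 0) (W 1) ω * R ω - √n * M ω - √n * √κ * R ω| ∂P :=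
        abs_integral_le_integral_abs
    _ ≤ ∫ ω, √n / √κ ^ 5 * (|Δ ω| ^ 3 * |R ω|) ∂P :=
        integral_mono (iDM.sub iR').abs (iAR.const_mul _) hpt
    _ = √n / √κ ^ 5 * ∫ ω, |Δ ω| ^ 3 * |R ω| ∂P := integral_const_mul _ _
    _ ≤ √n / √κ ^ 5 * (√18 * √((∫ ω, |Δ ω| ^ 6 ∂P) * ∫ ω, |Z 0 ω - Z 1 ω| ^ 2 ∂P)) := by
        gcongr
    _ = _ := by ring

end

end DistanceCovariance

/-- For each `n`, `D n 0` is the data and `D n 1`, `D n 2` are independent copies of it;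
`T n` is the test statistic and `V n` the vector of `n` statistics. -/
theorem proposition4p1
    {Ω : ℕ → Type*} [∀ n, MeasurableSpace (Ω n)]
    (P : ∀ n, Measure (Ω n)) [∀ n, IsProbabilityMeasure (P n)]
    {X : ℕ → Type*} [∀ n, MeasurableSpace (X n)]
    (D : ∀ n, Fin 3 → Ω n → X n)
    (hD : ∀ n k, Measurable (D n k))
    (hindep : ∀ n, iIndepFun (D n) (P n))
    (hident : ∀ n k, IdentDistrib (D n k) (D n 0) (P n) (P n))
    (T : ∀ n, X n → ℝ) (hT : ∀ n, Measurable (T n))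
    (V : ∀ n, X n → EuclideanSpace ℝ (Fin n)) (hV : ∀ n, Measurable (V n))
    (hmom : ∀ n, 1 ≤ n →
      Integrable (fun ω => |T n (D n 0 ω)| + √(∑ j, (V n (D n 0 ω) j) ^ 2)) (P n)) :
    let Z : ∀ n, Fin 3 → Ω n → ℝ := fun n k ω => T n (D n k ω)
    let W : ∀ n, Fin 3 → Ω n → EuclideanSpace ℝ (Fin n) := fun n k ω => V n (D n k ω)
    let dC : ℕ → ℝ := fun n => DistanceCovariance.dCov (P n) (Z n 0) (W n 0)
    let ϰ : ℕ → ℝ := fun n => DistanceCovariance.kap (P n) (W n 0)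
    let Δ : ∀ n, Ω n → ℝ := fun n => DistanceCovariance.Del (P n) (W n 0) (W n 1)
    let R : ∀ n, Ω n → ℝ := fun n => DistanceCovariance.Rstat (P n) (Z n 0) (Z n 1) (Z n 2)
    let d : ∀ n, Fin 3 → Ω n → ℝ := fun n k => DistanceCovariance.eDist (W n 0) (W n k)
    let M : ∀ n, Ω n → ℝ := fun n =>
      DistanceCovariance.mainTerm (P n) (Z n 0) (Z n 1) (Z n 2) (W n 0) (W n 1)
    -- the integral defining the distance covariance converges, and `0 ≤ dCov`
    (∀ n, 1 ≤ n →
      Integrable (DistanceCovariance.dCovIntegrand (P n) (Z n 0) (W n 0)) ∧ 0 ≤ dC n) ∧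
    -- the two representations, whose expectations exist
    (∀ n, 1 ≤ n →
      Integrable (fun ω => |Z n 0 ω| * √(∑ j, (W n 0 ω j) ^ 2)) (P n) →
      Integrable (fun ω => |Z n 0 ω - Z n 1 ω| * (1 * d n 1 ω + (-2) * d n 2 ω)) (P n) ∧
      Integrable (fun ω => |Z n 0 ω - Z n 1 ω|) (P n) ∧
      Integrable (d n 1) (P n) ∧
      Integrable (fun ω => d n 1 ω * R n ω) (P n) ∧
      dC n = (∫ ω, |Z n 0 ω - Z n 1 ω| * (1 * d n 1 ω + (-2) * d n 2 ω) ∂(P n))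
          + (∫ ω, |Z n 0 ω - Z n 1 ω| ∂(P n)) * (∫ ω, d n 1 ω ∂(P n)) ∧
      dC n = ∫ ω, d n 1 ω * R n ω ∂(P n)) ∧
    -- the expansion as `n → ∞`
    ((∀ n, 1 ≤ n → Integrable (fun ω => Z n 0 ω ^ 2) (P n)) →
      (∀ n, 1 ≤ n → Integrable (fun ω => |Δ n ω| ^ 6) (P n)) →
      (∃ c : ℝ, 0 < c ∧ ∀ᶠ n in atTop, c ≤ ϰ n) →
      (∀ n, 1 ≤ n → Integrable (M n) (P n)) ∧
      (fun n => dC n - √(n : ℝ) * ∫ ω, M n ω ∂(P n)) =O[atTop]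
        (fun n => √(n : ℝ) *
          √((∫ ω, |Δ n ω| ^ 6 ∂(P n)) * ∫ ω, |Z n 0 ω - Z n 1 ω| ^ 2 ∂(P n)))) := by
  intro Z W dC ϰ Δ R d M
  have hpair : ∀ n, Measurable fun x => (T n x, V n x) := fun n => (hT n).prodMk (hV n)
  have h : ∀ n, DistanceCovariance.IIDPairs (P n) (Z n) (W n) := fun n =>
    { measurable_fst := fun k => (hT n).comp (hD n k)
      measurable_snd := fun k => (hV n).comp (hD n k)
      indep := (hindep n).comp (fun _ x => (T n x, V n x)) fun _ => hpair n
      ident := fun k => (hident n k).comp (hpair n) }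
  have hnorm : ∀ n (x : EuclideanSpace ℝ (Fin n)), √(∑ j, x j ^ 2) = ‖x‖ := fun n x => by
    rw [← EuclideanSpace.real_norm_sq_eq, Real.sqrt_sq (norm_nonneg x)]
  have hZ : ∀ n, 1 ≤ n → Integrable (fun ω => ‖Z n 0 ω‖) (P n) := fun n hn =>
    (hmom n hn).mono' ((h n).measurable_fst 0).norm.aestronglyMeasurable
      (ae_of_all _ fun ω => by
        rw [norm_norm]; exact le_add_of_nonneg_right (Real.sqrt_nonneg _))
  have hW : ∀ n, 1 ≤ n → Integrable (fun ω => ‖W n 0 ω‖) (P n) := fun n hn =>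
    (hmom n hn).mono' ((h n).measurable_snd 0).norm.aestronglyMeasurable
      (ae_of_all _ fun ω => by
        rw [norm_norm, hnorm]; exact le_add_of_nonneg_left (abs_nonneg _))
  refine ⟨fun n hn => DistanceCovariance.integrable_dCovIntegrand_and_dCov_nonneg (h n)
    (hZ n hn) (hW n hn), fun n hn hZW => ?_, fun hZ2 hΔ ⟨c, hc, hcκ⟩ => ?_⟩
  · simp only [hnorm, ← Real.norm_eq_abs] at hZW
    obtain ⟨i1, e1⟩ := DistanceCovariance.dCov_eq_integral_add (h n) (hZ n hn) (hW n hn) hZW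
    obtain ⟨i2, e2⟩ :=
      DistanceCovariance.dCov_eq_integral_eDist_mul_Rstat (h n) (hZ n hn) (hW n hn) hZW
    have iW := (h n).swap.integrable_norm_sub_fst (hW n hn) 0 1
    exact ⟨i1, (h n).integrable_norm_sub_fst (hZ n hn) 0 1,
      iW.congr (ae_of_all _ fun ω => (DistanceCovariance.eDist_eq_norm _ _ ω).symm), i2, e1, e2⟩
  · have hL : ∀ n, 1 ≤ n → MemLp (Z n 0) 2 (P n) := fun n hn =>
      (memLp_two_iff_integrable_sq ((h n).measurable_fst 0).aestronglyMeasurable).2 (hZ2 n hn)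
    refine ⟨fun n hn => DistanceCovariance.integrable_mainTerm (h n) (hL n hn) (hΔ n hn),
      IsBigO.of_bound (√18 / √c ^ 5) ?_⟩
    filter_upwards [hcκ, eventually_ge_atTop 1] with n hn hn1
    rw [Real.norm_eq_abs, Real.norm_of_nonneg (by positivity)]
    refine (DistanceCovariance.abs_dCov_sub_le (h n) (by omega) (hL n hn1) (hΔ n hn1)
      (hc.trans_le hn)).trans ?_
    have hc' : 0 < √c := Real.sqrt_pos.2 hc
    have hle : √c ≤ √(DistanceCovariance.kap (P n) (W n 0)) := Real.sqrt_le_sqrt hn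
    gcongr
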